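/- Let $p$ be an odd prime, $n\ge 0$, and $K=\mathrm{GL}_n(\mathbb{Z}_p)$. Let $X$ be a random symmetric $n\times n$ matrix over $\mathbb{Z}_p$ whose entries $x_{ij}$, $i\le j$, are independent and distributed according to the Haar probability measure on $\mathbb{Z}_p$. Let $0\le k_1\le\dots\le k_n$ be integers, let $\Sigma=\mathrm{diag}(p^{k_1},\dots,p^{k_n})$, and let $m_t=\#\{i : k_i=t\}$ for $t\ge 0$. Then $\{X\in K\Sigma K\}$ (the event that $X$ has the matrix of elementary divisors $\Sigma$) is measurable and \[ \mathbb{P}\{X\in K\Sigma K\}=\frac{\pi_n}{\prod_{t\ge 0}\beta_{m_t}}\prod_{j=1}^{n}p^{-k_j(n-j+1)}, \] where \[ \pi_n=p^{-n^2}\,|\mathrm{GL}_n(\mathbb{F}_p)|=\prod_{i=1}^n(1-p^{-i}),\qquad \beta_t=\prod_{i=1}^{\lfloor t/2\rfloor}(1-p^{-2i}). \] Moreover, for every $t\ge 1$ and every non-square $r\in\mathbb{F}_p$, \[ \beta_t^{-1}=(\alpha_t^+)^{-1}+(\alpha_t^-)^{-1}, \] where $\alpha_t^{\pm}=p^{-t(t-1)/2}\,|\mathrm{O}_t^{\pm}(\mathbb{F}_p)|$,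 with $\mathrm{O}_t^{+}(\mathbb{F}_p)$ and $\mathrm{O}_t^{-}(\mathbb{F}_p)$ the groups of all $U\in\mathrm{GL}_t(\mathbb{F}_p)$ such that $UAU^{\top}=A$ for $A=\mathrm{diag}(1,\dots,1,1)$ and for $A=\mathrm{diag}(1,\dots,1,r)$, respectively. -/

import Mathlib

noncomputable section

namespace PadicSym

/-- The Haar measure on the additive group of `p`-adic integers, normalised to total mass `1`. -/
def haar (p : ℕ) [Fact p.Prime] [MeasurableSpace ℤ_[p]] [BorelSpace ℤ_[p]] :
    MeasureTheory.Measure ℤ_[p] :=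
  MeasureTheory.Measure.addHaarMeasure (⊤ : TopologicalSpace.PositiveCompacts ℤ_[p])

/-- `X` is a random symmetric `n × n` matrix over `ℤ_p` whose entries on and above the diagonal
are independent random variables, each distributed according to the Haar measure. -/
structure IsHaarSymmetric {Ω : Type*} [MeasurableSpace Ω] (P : MeasureTheory.Measure Ω)
    (p n : ℕ) [Fact p.Prime] [MeasurableSpace ℤ_[p]] [BorelSpace ℤ_[p]]
    (X : Ω → Matrix (Fin n) (Fin n) ℤ_[p]) : Prop where
  symm : ∀ ω, (X ω).IsSymm
  measurable : ∀ i j, Measurable fun ω => X ω i j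
  map_eq : ∀ i j, i ≤ j → P.map (fun ω => X ω i j) = haar p
  indep : ProbabilityTheory.iIndepFun
    (fun (e : {e : Fin n × Fin n // e.1 ≤ e.2}) (ω : Ω) => X ω e.1.1 e.1.2) P

/-- The matrix `Σ = diag(p^{k_1}, …, p^{k_n})`. -/
def divisorMatrix (p n : ℕ) [Fact p.Prime] (k : Fin n → ℕ) : Matrix (Fin n) (Fin n) ℤ_[p] :=
  Matrix.diagonal fun i => (p : ℤ_[p]) ^ k i

/-- The double coset `K Σ K` with `K = GL_n(ℤ_p)` and `Σ = diag(p^{k_1}, …, p^{k_n})`, i.e. the set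
of matrices with elementary divisors `p^{k_1}, …, p^{k_n}`. -/
def divisorClass (p n : ℕ) [Fact p.Prime] (k : Fin n → ℕ) : Set (Matrix (Fin n) (Fin n) ℤ_[p]) :=
  {M | ∃ U V : GL (Fin n) ℤ_[p],
    M = (U : Matrix (Fin n) (Fin n) ℤ_[p]) * divisorMatrix p n k * V}

/-- The multiplicity `m_t = #{i : k_i = t}`. -/
def mult {n : ℕ} (k : Fin n → ℕ) (t : ℕ) : ℕ :=
  (Finset.univ.filter fun i => k i = t).card

/-- `π_n = p^{-n²} |GL_n(𝔽_p)|`. -/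
def piDens (p n : ℕ) : ℝ := (Nat.card (GL (Fin n) (ZMod p)) : ℝ) / (p : ℝ) ^ (n ^ 2)

/-- `π_n = ∏_{i=1}^n (1 - p^{-i})`. -/
theorem piDens_eq_prod (p n : ℕ) [Fact p.Prime] :
    piDens p n = ∏ i ∈ Finset.Icc 1 n, (1 - ((p : ℝ) ^ i)⁻¹) := by
  have hp : (p : ℝ) ≠ 0 := by exact_mod_cast (Fact.out : p.Prime).ne_zero
  have hp1 : 1 ≤ p := (Fact.out : p.Prime).one_le
  unfold piDens
  rw [Matrix.card_GL_field, ZMod.card, Nat.cast_prod, sq, pow_mul, div_eq_iff (by positivity)]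
  have h : ((p : ℝ) ^ n) ^ n = ∏ _i : Fin n, (p : ℝ) ^ n := by simp
  rw [h, Fin.prod_univ_eq_prod_range (fun i => (((p ^ n - p ^ i : ℕ)) : ℝ)) n,
    Fin.prod_univ_eq_prod_range (fun _ => (p : ℝ) ^ n) n,
    ← Finset.prod_range_reflect (fun i => (((p ^ n - p ^ i : ℕ)) : ℝ)) n,
    ← Finset.Ico_add_one_right_eq_Icc, Finset.prod_Ico_eq_prod_range, Nat.add_sub_cancel,
    ← Finset.prod_mul_distrib]
  refine Finset.prod_congr rfl fun i hi => ?_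
  have hi' : i < n := Finset.mem_range.mp hi
  rw [Nat.cast_sub (Nat.pow_le_pow_right hp1 (by omega))]
  have e : (p : ℝ) ^ n = (p : ℝ) ^ (n - 1 - i) * (p : ℝ) ^ (1 + i) := by
    rw [← pow_add]; congr 1; omega
  push_cast
  rw [e]
  field_simp

/-- `β_t = ∏_{i=1}^{⌊t/2⌋} (1 - p^{-2i})`. -/
def betaDens (p t : ℕ) : ℝ := ∏ i ∈ Finset.Icc 1 (t / 2), (1 - ((p : ℝ) ^ (2 * i))⁻¹)

/-- The `t × t` identity matrix with its last diagonal entry replaced by `d`. For `d = 1` it is the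
identity matrix `1_t^+`; for `d` a fixed non-square it is `1_t^-`. -/
def signForm {R : Type*} [CommRing R] (t : ℕ) (d : R) : Matrix (Fin t) (Fin t) R :=
  Matrix.diagonal fun i => if (i : ℕ) + 1 = t then d else 1

/-- The density `p^{-t(t-1)/2} |O|` of the orthogonal group `O = {U ∈ GL_t(𝔽_p) : U A Uᵀ = A}` of
`A = diag(1, …, 1, d)`: this is `α_t^+` for `d = 1`, and `α_t^-` for `d` a non-square. -/
def alphaDens (p t : ℕ) (d : ZMod p) : ℝ :=
  (Nat.card {U : GL (Fin t) (ZMod p) //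
    (U : Matrix (Fin t) (Fin t) (ZMod p)) * signForm t d
      * (U : Matrix (Fin t) (Fin t) (ZMod p)).transpose = signForm t d} : ℝ)
    / (p : ℝ) ^ (t * (t - 1) / 2)

end PadicSym

end

/-! Reduce modulo `p`. If `X` has elementary divisors `p ^ k i`, its residue has rank `r = #{i : k i
= 0}` (`rank_map_toZMod_of_mem_smithClass`). Fix such a residue and write `X = a + p Y`; then `Y` is
again Haar (`card_mul_piHaar`). A congruence over `ℤ_p` preserves Haar measure and the double coset,
so `a` may be taken block diagonal with an invertible block of size `r` and zeros elsewhere.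
Splitting off the block of `X` that lifts it leaves `p` times a Schur complement `Z - p C M⁻¹ B`,
where `Z` is the lower right block of `Y`. Translating `Z` translates this expression, so it is Haar
symmetric of size `m = n - r` (`piHaar_fromBlocks_add`), and it must have divisors `p ^ (k i - 1)`.
Neither step depends on the residue beyond its rank.

Hence the probability is the proportion of rank `r` matrices among symmetric matrices over `𝔽_p`,
times the probability of the same kind for size `m`. That proportion is `π_n / (β_r π_m) *
p^{-m(m+1)/2}` (`rankCount_fin`), proved by adding one row and column at a time. Iterating over the
values of `k`, the `π` factors telescope, each multiplicity leaves one `β`, and the powers of `p`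
assemble to the stated product (`piHaar_real_smithSet`).

For the identity between `β` and `α^±`, invertible symmetric `t × t` matrices over `𝔽_p` form
exactly two orbits under congruence, with the two orthogonal groups as stabilizers. Adding the orbit
sizes and comparing with the full-rank case of `rankCount_fin` gives the claim (`inv_betaDens_eq`).
-/

namespace PadicSym

open Matrix

/-! ### Rank of a bordered symmetric matrix -/

section BorderedRank

variable {K : Type*} [Field K]

/-- Adding a column raises the rank exactly when it is not a combination of the old columns. -/
theorem rank_fromCols_replicateCol {m n : Type*} [Fintype m] [Fintype n]
    (A : Matrix m n K) (v : m → K) [Decidable (∃ w, A *ᵥ w = v)] :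
    (fromCols A (replicateCol Unit v)).rank = A.rank + if ∃ w, A *ᵥ w = v then 0 else 1 := by
  have hcol : Submodule.span K (Set.range (fromCols A (replicateCol Unit v)).col) =
      Submodule.span K (Set.range A.col) ⊔ Submodule.span K {v} := by
    rw [← Submodule.span_union]
    congr 1
    ext x
    simp only [Set.mem_range, Sum.exists, Set.mem_union, Set.mem_singleton_iff]
    constructor
    · rintro (⟨a, rfl⟩ | ⟨a, rfl⟩)
      · exact Or.inl ⟨a, rfl⟩
      · exact Or.inr rfl
    · rintro (⟨a, rfl⟩ | rfl)
      · exact Or.inl ⟨a, rfl⟩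
      · exact Or.inr ⟨(), rfl⟩
  have hmem : v ∈ Submodule.span K (Set.range A.col) ↔ ∃ w, A *ᵥ w = v := by
    rw [← range_mulVecLin]
    simp
  rw [rank_eq_finrank_span_cols, rank_eq_finrank_span_cols, hcol]
  split_ifs with h
  · rw [sup_eq_left.mpr]
    · simp
    · simpa [Submodule.span_singleton_le_iff_mem] using hmem.mpr h
  · exact Submodule.finrank_sup_span_singleton (fun h' => h (hmem.mp h'))

/-- The symmetric matrix `[[A, v], [vᵀ, c]]`. -/
def border {ι R : Type*} (A : Matrix ι ι R) (v : ι → R) (c : R) :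
    Matrix (ι ⊕ Unit) (ι ⊕ Unit) R :=
  fromBlocks A (replicateCol Unit v) (replicateRow Unit v) (of fun _ _ => c)

theorem border_eq_fromCols {ι R : Type*} (A : Matrix ι ι R) (v : ι → R) (c : R) :
    border A v c = fromCols (fromRows A (replicateRow Unit v))
      (replicateCol Unit (Sum.elim v fun _ => c)) := by
  ext (i | i) (j | j) <;> rfl

theorem rank_fromRows_replicateRow {ι : Type*} [Fintype ι] (A : Matrix ι ι K) (hA : A.IsSymm)
    (v : ι → K) [Decidable (∃ w, A *ᵥ w = v)] :
    (fromRows A (replicateRow Unit v)).rank = A.rank + if ∃ w, A *ᵥ w = v then 0 else 1 := by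
  rw [← rank_transpose, transpose_fromRows, hA.eq, transpose_replicateRow,
    rank_fromCols_replicateCol]

/-- Eliminating with `w` clears the border and leaves the corner `c - wᵀ A w`; the rank grows
exactly when this is nonzero. -/
theorem rank_border_of_mem {ι : Type*} [Fintype ι] (A : Matrix ι ι K) (hA : A.IsSymm)
    (w : ι → K) (c : K) [Decidable (c = w ⬝ᵥ A *ᵥ w)] :
    (border A (A *ᵥ w) c).rank = A.rank + if c = w ⬝ᵥ A *ᵥ w then 0 else 1 := by
  classical
  rw [border_eq_fromCols, rank_fromCols_replicateCol, rank_fromRows_replicateRow A hA,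
    if_pos ⟨w, rfl⟩, add_zero]
  congr 2
  rw [eq_iff_iff]
  have key : ∀ u, (A *ᵥ w) ⬝ᵥ u = w ⬝ᵥ A *ᵥ u := fun u => by
    rw [dotProduct_mulVec, ← mulVec_transpose, hA.eq]
  constructor
  · rintro ⟨u, hu⟩
    rw [fromRows_mulVec] at hu
    have h1 : A *ᵥ u = A *ᵥ w := funext fun i => congrFun hu (Sum.inl i)
    have h2 : (A *ᵥ w) ⬝ᵥ u = c := congrFun hu (Sum.inr ())
    rw [← h2, key, h1]
  · rintro rfl
    refine ⟨w, ?_⟩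
    rw [fromRows_mulVec]
    congr 1
    ext
    exact key w

/-- By symmetry the new row and the new column each contribute one to the rank, whatever the corner
is. -/
theorem rank_border_of_not_mem {ι : Type*} [Fintype ι] (A : Matrix ι ι K) (hA : A.IsSymm)
    (v : ι → K) (c : K) (hv : ¬ ∃ w, A *ᵥ w = v) :
    (border A v c).rank = A.rank + 2 := by
  classical
  rw [border_eq_fromCols, rank_fromCols_replicateCol, rank_fromRows_replicateRow A hA,
    if_neg hv, if_neg]
  rintro ⟨u, hu⟩
  rw [fromRows_mulVec] at hu
  exact hv ⟨u, funext fun i => congrFun hu (Sum.inl i)⟩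

end BorderedRank

/-! ### Symmetric matrices of given rank over `𝔽_p` -/

section Counting

/-- A symmetric matrix with one more row and column is a bordered symmetric matrix. -/
def borderEquiv (ι R : Type*) :
    {A : Matrix ι ι R // A.IsSymm} × (ι → R) × R ≃
      {M : Matrix (ι ⊕ Unit) (ι ⊕ Unit) R // M.IsSymm} where
  toFun x := ⟨border x.1.1 x.2.1 x.2.2, by
    refine IsSymm.fromBlocks x.1.2 ?_ ?_ <;> ext <;> rfl⟩
  invFun M := (⟨M.1.toBlocks₁₁, by
    ext i j; exact M.2.apply (Sum.inl i) (Sum.inl j)⟩,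
    fun i => M.1 (Sum.inl i) (Sum.inr ()), M.1 (Sum.inr ()) (Sum.inr ()))
  left_inv x := rfl
  right_inv M := by
    ext (i | i) (j | j)
    · rfl
    · rfl
    · exact (M.2.apply (Sum.inr ()) (Sum.inl j)).symm ▸ rfl
    · rfl

variable (p : ℕ) [Fact p.Prime]

set_option linter.unusedSectionVars false

noncomputable instance symmFintype {ι : Type*} [Finite ι] :
    Fintype {M : Matrix ι ι (ZMod p) // M.IsSymm} :=
  Fintype.ofFinite _

/-- The number of symmetric matrices of rank `r` over `𝔽_p`. -/
noncomputable def rankCount (ι : Type*) [Fintype ι] (r : ℕ) : ℕ :=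
  Nat.card {M : {M : Matrix ι ι (ZMod p) // M.IsSymm} // M.1.rank = r}

theorem rankCount_congr {ι κ : Type*} [Fintype ι] [Fintype κ] (e : ι ≃ κ) (r : ℕ) :
    rankCount p ι r = rankCount p κ r := by
  classical
  refine Nat.card_congr (Equiv.subtypeEquiv (Equiv.subtypeEquiv (reindex e e) fun M => ?_)
    fun M => ?_)
  · constructor
    · intro h; exact h.submatrix _
    · intro h
      have := h.submatrix e
      simpa using this
  · change _ ↔ (reindex e e M.1).rank = r
    rw [rank_reindex]

open Classical in
theorem rankCount_eq_sum (ι : Type*) [Fintype ι] (r : ℕ) :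
    (rankCount p ι r : ℝ) =
      ∑ M : {M : Matrix ι ι (ZMod p) // M.IsSymm}, if M.1.rank = r then 1 else 0 := by
  rw [rankCount, Nat.card_eq_fintype_card, Fintype.card_subtype]
  simp

-- There are `p ^ rank A` borders in the column space of `A`; for each, one corner keeps the rank
-- and `p - 1` corners raise it by one. Every other border raises it by two for all `p` corners.
open Classical in
theorem sum_border_rank {ι : Type*} [Fintype ι] (A : Matrix ι ι (ZMod p)) (hA : A.IsSymm)
    (r : ℕ) :
    (∑ v : ι → ZMod p, ∑ c : ZMod p, if (border A v c).rank = r then (1 : ℝ) else 0) =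
      (p : ℝ) ^ A.rank * (if A.rank = r then 1 else 0)
        + (p : ℝ) ^ A.rank * (p - 1) * (if A.rank + 1 = r then 1 else 0)
        + ((p : ℝ) ^ (Fintype.card ι + 1) - (p : ℝ) ^ (A.rank + 1)) *
          (if A.rank + 2 = r then 1 else 0) := by
  have h1 : ∀ v : ι → ZMod p,
      (∑ c : ZMod p, if (border A v c).rank = r then (1 : ℝ) else 0) =
        (if v ∈ LinearMap.range A.mulVecLin then
          (if A.rank = r then (1 : ℝ) else 0) + ((p : ℝ) - 1) * (if A.rank + 1 = r then 1 else 0)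
        else (p : ℝ) * (if A.rank + 2 = r then 1 else 0) : ℝ) := by
    intro v
    by_cases hv : v ∈ LinearMap.range A.mulVecLin
    · rw [if_pos hv]
      obtain ⟨w, rfl⟩ := hv
      have h2 : ∀ c : ZMod p, (if (border A (A.mulVecLin w) c).rank = r then (1 : ℝ) else 0) =
          (if c = w ⬝ᵥ A *ᵥ w then
            (if A.rank = r then (1 : ℝ) else 0) - (if A.rank + 1 = r then 1 else 0) else 0) +
          (if A.rank + 1 = r then 1 else 0) := by
        intro c
        rw [mulVecLin_apply, rank_border_of_mem A hA]
        by_cases hc : c = w ⬝ᵥ A *ᵥ w <;> simp [hc]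
      rw [Finset.sum_congr rfl fun c _ => h2 c, Finset.sum_add_distrib, Finset.sum_ite_eq',
        if_pos (Finset.mem_univ _), Finset.sum_const, Finset.card_univ, ZMod.card, nsmul_eq_mul]
      ring_nf
    · rw [if_neg hv]
      have h2 : ∀ c : ZMod p, (border A v c).rank = A.rank + 2 :=
        fun c => rank_border_of_not_mem A hA v c hv
      simp only [h2, Finset.sum_const, Finset.card_univ, ZMod.card, nsmul_eq_mul]
  rw [Finset.sum_congr rfl fun v _ => h1 v, Finset.sum_ite, Finset.sum_const, Finset.sum_const]
  have hc : (Finset.univ.filter fun v => v ∈ LinearMap.range A.mulVecLin).card = p ^ A.rank := by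
    rw [← Fintype.card_subtype]
    have := Module.card_eq_pow_finrank (K := ZMod p) (V := LinearMap.range A.mulVecLin)
    rw [ZMod.card] at this
    convert this
    exact (Matrix.rank.eq_1 A).symm ▸ rfl
  have hc' : ((Finset.univ.filter fun v => ¬ v ∈ LinearMap.range A.mulVecLin).card : ℝ) =
      (p : ℝ) ^ Fintype.card ι - (p : ℝ) ^ A.rank := by
    have := Finset.card_filter_add_card_filter_not (s := (Finset.univ : Finset (ι → ZMod p)))
      (fun v => v ∈ LinearMap.range A.mulVecLin)
    rw [hc, Finset.card_univ, Fintype.card_fun, ZMod.card] at this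
    rw [eq_sub_iff_add_eq']
    exact_mod_cast this
  rw [nsmul_eq_mul, nsmul_eq_mul, hc, hc']
  push_cast
  ring

open Classical in
theorem rankCount_border (ι : Type*) [Fintype ι] (r : ℕ) :
    (rankCount p (ι ⊕ Unit) r : ℝ) = ∑ A : {A : Matrix ι ι (ZMod p) // A.IsSymm},
      ((p : ℝ) ^ A.1.rank * (if A.1.rank = r then 1 else 0)
        + (p : ℝ) ^ A.1.rank * (p - 1) * (if A.1.rank + 1 = r then 1 else 0)
        + ((p : ℝ) ^ (Fintype.card ι + 1) - (p : ℝ) ^ (A.1.rank + 1)) *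
          (if A.1.rank + 2 = r then 1 else 0)) := by
  rw [rankCount_eq_sum]
  refine (Fintype.sum_equiv (borderEquiv ι (ZMod p)) (fun x =>
    if (border x.1.1 x.2.1 x.2.2).rank = r then (1 : ℝ) else 0) _ fun _ => rfl).symm.trans ?_
  rw [Fintype.sum_prod_type]
  refine Finset.sum_congr rfl fun A _ => ?_
  rw [Fintype.sum_prod_type, ← sum_border_rank p A.1 A.2 r]

open Classical in
theorem sum_ite_rank (ι : Type*) [Fintype ι] (f : ℕ → ℝ) (r : ℕ) :
    (∑ A : {A : Matrix ι ι (ZMod p) // A.IsSymm}, f A.1.rank * (if A.1.rank = r then 1 else 0)) =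
      f r * rankCount p ι r := by
  rw [rankCount_eq_sum, Finset.mul_sum]
  refine Finset.sum_congr rfl fun A _ => ?_
  by_cases h : A.1.rank = r
  · rw [h]
  · simp [h]

/-- Ranks 0 and 1 are separate from the general recursion, which refers to the two preceding ranks.
-/
theorem rankCount_border_zero (ι : Type*) [Fintype ι] :
    (rankCount p (ι ⊕ Unit) 0 : ℝ) = rankCount p ι 0 := by
  classical
  have := sum_ite_rank p ι (fun s => (p : ℝ) ^ s) 0
  rw [rankCount_border]
  simpa using this

theorem rankCount_border_one (ι : Type*) [Fintype ι] :
    (rankCount p (ι ⊕ Unit) 1 : ℝ) = p * rankCount p ι 1 + (p - 1) * rankCount p ι 0 := by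
  classical
  have h1 := sum_ite_rank p ι (fun s => (p : ℝ) ^ s) 1
  have h2 := sum_ite_rank p ι (fun s => (p : ℝ) ^ s * (p - 1)) 0
  rw [rankCount_border]
  simp only [Finset.sum_add_distrib] at *
  simp only [Nat.add_eq_right, Nat.reduceEqDiff, if_false, mul_zero, Finset.sum_const_zero,
    pow_one, pow_zero, one_mul] at *
  rw [h1]
  simpa using h2

theorem rankCount_border_add_two (ι : Type*) [Fintype ι] (r : ℕ) :
    (rankCount p (ι ⊕ Unit) (r + 2) : ℝ) = (p : ℝ) ^ (r + 2) * rankCount p ι (r + 2)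
      + (p : ℝ) ^ (r + 1) * (p - 1) * rankCount p ι (r + 1)
      + ((p : ℝ) ^ (Fintype.card ι + 1) - (p : ℝ) ^ (r + 1)) * rankCount p ι r := by
  rw [rankCount_border]
  simp only [Finset.sum_add_distrib, Nat.add_right_cancel_iff,
    show ∀ s, s + 1 = r + 2 ↔ s = r + 1 from fun s => by omega]
  rw [sum_ite_rank p ι (fun s => (p : ℝ) ^ s), sum_ite_rank p ι (fun s => (p : ℝ) ^ s * (p - 1)),
    sum_ite_rank p ι (fun s => (p : ℝ) ^ (Fintype.card ι + 1) - (p : ℝ) ^ (s + 1))]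

theorem rankCount_eq_zero (ι : Type*) [Fintype ι] (r : ℕ) (h : Fintype.card ι < r) :
    rankCount p ι r = 0 := by
  rw [rankCount, Nat.card_eq_zero]
  refine Or.inl ⟨fun M => ?_⟩
  have := rank_le_card_width M.1.1
  have := M.2
  omega

theorem piDens_zero : piDens p 0 = 1 := by
  rw [piDens_eq_prod]; simp

theorem piDens_succ (n : ℕ) : piDens p (n + 1) = piDens p n * (1 - ((p : ℝ) ^ (n + 1))⁻¹) := by
  rw [piDens_eq_prod, piDens_eq_prod, Finset.prod_Icc_succ_top (by omega)]

theorem betaDens_add_two (t : ℕ) :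
    betaDens p (t + 2) = betaDens p t * (1 - ((p : ℝ) ^ (2 * (t / 2 + 1)))⁻¹) := by
  rw [betaDens, betaDens, Nat.add_div_right _ (by omega), Finset.prod_Icc_succ_top (by omega)]

theorem one_sub_inv_pow_pos (i : ℕ) (hi : i ≠ 0) : 0 < 1 - ((p : ℝ) ^ i)⁻¹ := by
  have hp : (1 : ℝ) < p := by exact_mod_cast (Fact.out : p.Prime).one_lt
  exact sub_pos.mpr (inv_lt_one_of_one_lt₀ (one_lt_pow₀ hp hi))

theorem piDens_pos (n : ℕ) : 0 < piDens p n := by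
  rw [piDens_eq_prod]
  exact Finset.prod_pos fun i hi => one_sub_inv_pow_pos p i (by simp at hi; omega)

theorem betaDens_pos (t : ℕ) : 0 < betaDens p t :=
  Finset.prod_pos fun i hi => one_sub_inv_pow_pos p (2 * i) (by simp at hi; omega)

theorem betaDens_zero : betaDens p 0 = 1 := by simp [betaDens]

theorem betaDens_one : betaDens p 1 = 1 := by simp [betaDens]

theorem betaDens_succ_of_even (t : ℕ) (ht : Even t) : betaDens p (t + 1) = betaDens p t := by
  obtain ⟨s, rfl⟩ := ht
  rw [betaDens, betaDens, show (s + s + 1) / 2 = (s + s) / 2 by omega]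

theorem rankCount_succ (n r : ℕ) : rankCount p (Fin (n + 1)) r = rankCount p (Fin n ⊕ Unit) r :=
  rankCount_congr p (Fintype.equivOfCardEq (by simp)) r

theorem rankCount_zero_zero : rankCount p (Fin 0) 0 = 1 := by
  have h : ∀ M : Matrix (Fin 0) (Fin 0) (ZMod p), M.rank = 0 := fun M => by
    simpa using rank_le_card_width M
  have hs : ∀ M : Matrix (Fin 0) (Fin 0) (ZMod p), M.IsSymm := fun M => Subsingleton.elim _ _
  rw [rankCount, Nat.card_eq_one_iff_unique]
  exact ⟨inferInstance, ⟨⟨⟨0, hs 0⟩, h 0⟩⟩⟩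

/-- The number of symmetric matrices of rank `r` and corank `d`. -/
theorem rankCount_fin (n r d : ℕ) (h : r + d = n) :
    (rankCount p (Fin n) r : ℝ) = (p : ℝ) ^ (n + 1).choose 2 *
      (piDens p n / (betaDens p r * piDens p d) * ((p : ℝ) ^ (d + 1).choose 2)⁻¹) := by
  have hp : (p : ℝ) ≠ 0 := by exact_mod_cast (Fact.out : p.Prime).ne_zero
  have hpi : ∀ i, piDens p i ≠ 0 := fun i => (piDens_pos p i).ne'
  have hbeta : ∀ i, betaDens p i ≠ 0 := fun i => (betaDens_pos p i).ne'
  have hx : ∀ i, i ≠ 0 → 1 - ((p : ℝ) ^ i)⁻¹ ≠ 0 := fun i hi => (one_sub_inv_pow_pos p i hi).ne'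
  have hx' : ∀ i, i ≠ 0 → (p : ℝ) ^ i - 1 ≠ 0 := fun i hi h0 => hx i hi (by
    rw [sub_eq_zero.mp h0]; simp)
  have hch : ∀ i : ℕ, (i + 1 + 1).choose 2 = (i + 1).choose 2 + (i + 1) := fun i => by
    rw [Nat.choose_succ_succ' (i + 1) 1, Nat.choose_one_right, add_comm]
  have hz : ∀ n, (rankCount p (Fin n) 0 : ℝ) = 1 := by
    intro n
    induction n with
    | zero => simp [rankCount_zero_zero]
    | succ n ih => rw [rankCount_succ, rankCount_border_zero, ih]
  induction n generalizing r d with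
  | zero =>
    obtain ⟨rfl, rfl⟩ : r = 0 ∧ d = 0 := by omega
    simp [rankCount_zero_zero, piDens_zero, betaDens_zero]
  | succ n ih =>
    -- For size `n` the corank is `d - 1`. Written with the factor `1 - p^{-d}`, which vanishes at
    -- `d = 0`, the formula also covers `r = n + 1`, where the count is zero.
    have hfirst : (rankCount p (Fin n) r : ℝ) = (p : ℝ) ^ (n + 1).choose 2 *
        (piDens p n * (1 - ((p : ℝ) ^ d)⁻¹) / (betaDens p r * piDens p d) *
          ((p : ℝ) ^ (d + 1).choose 2)⁻¹ * (p : ℝ) ^ d) := by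
      rcases d with _ | d
      · rw [rankCount_eq_zero p (Fin n) r (by rw [Fintype.card_fin]; omega)]
        simp
      · rw [ih r d (by omega), hch d, piDens_succ p d]
        have := hx (d + 1) (by omega)
        have := hx' (d + 1) (by omega)
        have := hpi d
        have := hbeta r
        field_simp
        ring
    rw [hch n, piDens_succ p n]
    rcases r with _ | _ | r
    · obtain rfl : d = n + 1 := by omega
      rw [hz, betaDens_zero, hch n, piDens_succ p n]
      have := hx (n + 1) (by omega)
      have := hx' (n + 1) (by omega)
      have := hpi n
      field_simp
    · obtain rfl : d = n := by omega
      rw [rankCount_succ, rankCount_border_one]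
      simp only [zero_add] at *
      rw [hfirst, hz, betaDens_one]
      have := hpi d
      field_simp
      ring
    · rw [rankCount_succ, rankCount_border_add_two, hfirst, ih (r + 1) d (by omega),
        ih r (d + 1) (by omega), hch d, piDens_succ p d, betaDens_add_two]
      have h1 := hx (d + 1) (by omega)
      have h2 := hpi d
      have h3 := hpi n
      have h4 := hbeta r
      obtain rfl : n = r + d + 1 := by omega
      rw [Fintype.card_fin]
      -- Parity decides whether `β` gains its new factor in passing from `r` to `r + 1` or from `r +
      -- 1` to `r + 2`.
      rcases Nat.even_or_odd r with hr | hr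
      · rw [betaDens_succ_of_even p r hr]
        obtain ⟨s, rfl⟩ := hr
        have h5 := hx (2 * ((s + s) / 2 + 1)) (by omega)
        rw [show 2 * ((s + s) / 2 + 1) = s + s + 2 by omega] at *
        have h6 := hx' (s + s + 2) (by omega)
        have h7 := hx' (d + 1) (by omega)
        field_simp
        ring
      · rw [← betaDens_succ_of_even p (r + 1) hr.add_one, betaDens_add_two]
        obtain ⟨s, rfl⟩ := hr
        have h5 := hx (2 * ((2 * s + 1) / 2 + 1)) (by omega)
        rw [show 2 * ((2 * s + 1) / 2 + 1) = 2 * s + 2 by omega] at *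
        have h6 := hx' (2 * s + 2) (by omega)
        have h7 := hx' (d + 1) (by omega)
        field_simp
        ring

end Counting

end PadicSym

namespace PadicSym

open Matrix

/-! ### Orthogonal families over finite fields of odd order -/

section Classification

variable {K : Type*} [Field K]

theorem rank_eq_card_iff_isUnit {ι : Type*} [Fintype ι] [DecidableEq ι] (A : Matrix ι ι K) :
    A.rank = Fintype.card ι ↔ IsUnit A := by
  refine ⟨fun h => ?_, fun h => rank_of_isUnit A h⟩
  rw [← mulVec_surjective_iff_isUnit]
  have : LinearMap.range A.mulVecLin = ⊤ := by
    apply Submodule.eq_top_of_finrank_eq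
    rw [Module.finrank_fintype_fun_eq_card, ← h]
    rfl
  exact LinearMap.range_eq_top.mp this

/-- `v` is an orthogonal family for `B` with norms `w`. -/
def HasGram {ι V : Type*} [DecidableEq ι] [AddCommGroup V] [Module K V]
    (B : LinearMap.BilinForm K V) (v : ι → V) (w : ι → K) : Prop :=
  ∀ a b, B (v a) (v b) = if a = b then w a else 0


theorem exists_mul_sq_add_mul_sq_eq_one [Fintype K] (hK : Fintype.card K % 2 = 1) {a b : K} (ha : a ≠ 0)
    (hb : b ≠ 0) : ∃ x y : K, a * x ^ 2 + b * y ^ 2 = 1 := by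
  open Polynomial in
  obtain ⟨x, y, h⟩ := FiniteField.exists_root_sum_quadratic (R := K)
    (f := C a * X ^ 2) (g := C b * X ^ 2 - C 1) (degree_C_mul_X_pow 2 ha)
    (by compute_degree!) hK
  refine ⟨x, y, ?_⟩
  simp only [Polynomial.eval_mul, Polynomial.eval_sub, Polynomial.eval_pow, Polynomial.eval_C,
    Polynomial.eval_X] at h
  linear_combination h

variable {ι V : Type*} [DecidableEq ι] [AddCommGroup V] [Module K V]

/-- The form `w i x² + w j y²` represents 1, so the plane of `v i` and `v j` has an orthogonal pair
of norms 1 and `w i * w j`. This pushes the norm at `i` into the index `j`. -/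
theorem HasGram.move [Fintype K] (hK : Fintype.card K % 2 = 1) {B : LinearMap.BilinForm K V} {v : ι → V}
    {w : ι → K} (h : HasGram B v w) (hw : ∀ i, w i ≠ 0) {i j : ι} (hij : i ≠ j) :
    ∃ v', HasGram B v' (Function.update (Function.update w i 1) j (w i * w j)) := by
  obtain ⟨x, y, hxy⟩ := exists_mul_sq_add_mul_sq_eq_one hK (hw i) (hw j)
  have hji := hij.symm
  have hii := h i i
  have hjj := h j j
  have hij' := h i j
  have hji' := h j i
  rw [if_pos rfl] at hii hjj
  rw [if_neg hij] at hij'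
  rw [if_neg hji] at hji'
  set e := x • v i + y • v j with he
  -- The vector orthogonal to `e` in the plane, scaled so that the change of basis has determinant
  -- `w i x² + w j y² = 1`; hence its norm is `w i * w j`.
  set f := -(w j * y) • v i + (w i * x) • v j with hf
  have hee : B e e = 1 := by
    simp only [he, map_add, map_smul, LinearMap.add_apply, LinearMap.smul_apply, smul_eq_mul, hii,
      hjj, hij', hji']
    linear_combination hxy
  have hef : B e f = 0 := by
    simp only [he, hf, map_add, map_smul, LinearMap.add_apply, LinearMap.smul_apply, smul_eq_mul,
      hii, hjj, hij', hji']
    ring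
  have hfe : B f e = 0 := by
    simp only [he, hf, map_add, map_smul, LinearMap.add_apply, LinearMap.smul_apply, smul_eq_mul,
      hii, hjj, hij', hji']
    ring
  have hff : B f f = w i * w j := by
    simp only [hf, map_add, map_smul, LinearMap.add_apply, LinearMap.smul_apply, smul_eq_mul,
      hii, hjj, hij', hji']
    linear_combination (w i * w j) * hxy
  have hother : ∀ b, b ≠ i → b ≠ j →
      B e (v b) = 0 ∧ B (v b) e = 0 ∧ B f (v b) = 0 ∧ B (v b) f = 0 := by
    intro b hbi hbj
    simp [he, hf, h _ _, hbi, hbj, hbi.symm, hbj.symm]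
  refine ⟨Function.update (Function.update v i e) j f, fun a b => ?_⟩
  rcases eq_or_ne a j with haj | haj
  · rcases eq_or_ne b j with hbj | hbj
    · simp [haj, hbj, hff]
    · rcases eq_or_ne b i with hbi | hbi
      · simp [haj, hbi, hij, hji, hfe]
      · simp [haj, hbi, hbj, hbj.symm, hother b hbi hbj]
  · rcases eq_or_ne a i with hai | hai
    · rcases eq_or_ne b j with hbj | hbj
      · simp [hai, hbj, hij, hef]
      · rcases eq_or_ne b i with hbi | hbi
        · simp [hai, hbi, hij, hee]
        · simp [hai, hbi, hbj, hij, hbi.symm, hother b hbi hbj]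
    · rcases eq_or_ne b j with hbj | hbj
      · simp [haj, hai, hbj, hother a hai haj]
      · rcases eq_or_ne b i with hbi | hbi
        · simp [haj, hai, hbi, hij, hother a hai haj]
        · simp [haj, hai, hbi, hbj, h a b]

/-- Over a finite field of odd order an orthogonal family can be normalised outside one index. -/
theorem HasGram.exists_normalised [Fintype K] (hK : Fintype.card K % 2 = 1) {B : LinearMap.BilinForm K V}
    {v : ι → V} {w : ι → K} (h : HasGram B v w) (hw : ∀ i, w i ≠ 0) (j : ι) (s : Finset ι)
    (hs : j ∉ s) :
    ∃ v' w', HasGram B v' w' ∧ (∀ i, w' i ≠ 0) ∧ ∀ i ∈ s, w' i = 1 := by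
  induction s using Finset.induction_on with
  | empty => exact ⟨v, w, h, hw, by simp⟩
  | insert i s his ih =>
    rw [Finset.mem_insert, not_or] at hs
    obtain ⟨v', w', h', hw', hs'⟩ := ih hs.2
    obtain ⟨v'', h''⟩ := h'.move hK hw' (Ne.symm hs.1)
    refine ⟨v'', _, h'', fun a => ?_, fun a ha => ?_⟩
    · rcases eq_or_ne a j with rfl | haj
      · simp [hw']
      · rcases eq_or_ne a i with rfl | hai
        · simp [haj]
        · simp [haj, hai, hw']
    · have haj : a ≠ j := by
        rintro rfl
        rcases Finset.mem_insert.mp ha with h0 | h0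
        · exact hs.1 h0
        · exact hs.2 h0
      rcases eq_or_ne a i with rfl | hai
      · simp [haj]
      · simp [haj, hai, hs' a (Finset.mem_of_mem_insert_of_ne ha hai)]

theorem HasGram.scale {B : LinearMap.BilinForm K V} {v : ι → V} {w : ι → K} (h : HasGram B v w)
    (j : ι) (c : K) : HasGram B (Function.update v j (c • v j))
      (Function.update w j (c ^ 2 * w j)) := by
  intro a b
  rcases eq_or_ne a j with haj | haj
  · rcases eq_or_ne b j with hbj | hbj
    · simp [haj, hbj, h j j]; ring
    · simp [haj, hbj, hbj.symm, h j b]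
  · rcases eq_or_ne b j with hbj | hbj
    · simp [haj, hbj, h a j]
    · simp [haj, hbj, h a b]

/-- The quadratic character is multiplicative, so a product of two non-squares is a square. -/
theorem exists_eq_sq_mul_of_not_isSquare [Fintype K] [DecidableEq K] {d r : K}
    (hd : ¬ IsSquare d) (hr : ¬ IsSquare r) : ∃ c : K, c ^ 2 * d = r := by
  have hd0 : d ≠ 0 := by rintro rfl; exact hd IsSquare.zero
  have hr0 : r ≠ 0 := by rintro rfl; exact hr IsSquare.zero
  have hmul : IsSquare (r * d) := by
    rw [← quadraticChar_one_iff_isSquare (mul_ne_zero hr0 hd0), map_mul,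
      quadraticChar_neg_one_iff_not_isSquare.mpr hd, quadraticChar_neg_one_iff_not_isSquare.mpr hr]
    norm_num
  obtain ⟨c, hc⟩ := hmul
  refine ⟨c / d, ?_⟩
  field_simp
  rw [mul_comm d r, hc]; ring

end Classification

/-! ### Congruence classes of invertible symmetric matrices -/

section Orthogonal

variable {K : Type*} [Field K] {ι : Type*} [Fintype ι] [DecidableEq ι]

/-- Here `W` is read as the family of its rows, which translates between orthogonal families and
congruence. -/
theorem hasGram_toBilin'_iff (A : Matrix ι ι K) (W : Matrix ι ι K) (w : ι → K) :
    HasGram (toBilin' A) W w ↔ W * A * Wᵀ = diagonal w := by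
  rw [← Matrix.ext_iff]
  refine forall₂_congr fun a b => ?_
  rw [toBilin'_apply', diagonal_apply, mul_mul_apply]
  rfl

theorem signForm_isSymm (t : ℕ) (d : K) : (signForm t d).IsSymm := isSymm_diagonal _

theorem signForm_succ (t : ℕ) (d : K) :
    signForm (t + 1) d = diagonal (Function.update 1 (Fin.last t) d) := by
  rw [signForm]
  congr 1
  ext i
  rcases eq_or_ne i (Fin.last t) with rfl | hi
  · simp
  · have : (i : ℕ) ≠ t := fun h => hi (Fin.ext h)
    simp [hi, this]

theorem det_signForm {t : ℕ} (d : K) : (signForm (t + 1) d).det = d := by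
  rw [signForm_succ, det_diagonal, Finset.prod_update_of_mem (Finset.mem_univ _)]
  simp

/-- An invertible symmetric matrix over a finite field of odd order is congruent to
`diag(1, …, 1, 1)` or to `diag(1, …, 1, r)`. -/
theorem exists_congruent_signForm [Fintype K] (hK : Fintype.card K % 2 = 1) {t : ℕ}
    (ht : 1 ≤ t) {r : K} (hr : ¬ IsSquare r) (A : Matrix (Fin t) (Fin t) K) (hA : A.IsSymm)
    (hu : IsUnit A) : ∃ U : GL (Fin t) K,
      (U : Matrix (Fin t) (Fin t) K) * A * (U : Matrix (Fin t) (Fin t) K)ᵀ = signForm t 1 ∨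
      (U : Matrix (Fin t) (Fin t) K) * A * (U : Matrix (Fin t) (Fin t) K)ᵀ = signForm t r := by
  classical
  obtain ⟨t, rfl⟩ : ∃ s, t = s + 1 := ⟨t - 1, by omega⟩
  have h2 : (2 : K) ≠ 0 := by
    apply Ring.two_ne_zero
    rw [Ne, FiniteField.even_card_iff_char_two]
    omega
  have : Invertible (2 : K) := invertibleOfNonzero h2
  have hB : LinearMap.IsSymm (toBilin' A) := ⟨fun x y => by
    rw [toBilin'_apply', toBilin'_apply', dotProduct_mulVec, ← mulVec_transpose, hA.eq,
      dotProduct_comm, RingHom.id_apply]⟩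
  obtain ⟨v, hv⟩ := LinearMap.BilinForm.exists_orthogonal_basis hB
  let v' := v.reindex (finCongr (Module.finrank_fin_fun K))
  have hgram : HasGram (toBilin' A) v' fun a => toBilin' A (v' a) (v' a) := by
    intro a b
    split_ifs with hab
    · rw [hab]
    · simp only [v', Module.Basis.reindex_apply]
      exact hv (by simpa using hab)
  have hunit : IsUnit (of v' : Matrix (Fin (t + 1)) (Fin (t + 1)) K) :=
    linearIndependent_rows_iff_isUnit.mp v'.linearIndependent
  have hw : ∀ a, toBilin' A (v' a) (v' a) ≠ 0 := by
    have h := (hasGram_toBilin'_iff A (of v') _).mp hgram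
    have hd := ((hunit.mul hu).mul ((isUnit_transpose _).mpr hunit))
    rw [h, isUnit_iff_isUnit_det, det_diagonal, isUnit_iff_ne_zero, Finset.prod_ne_zero_iff] at hd
    exact fun a => hd a (Finset.mem_univ a)
  obtain ⟨v₁, w₁, h₁, hw₁, hone⟩ := hgram.exists_normalised hK hw (Fin.last t)
    (Finset.univ.erase (Fin.last t)) (Finset.notMem_erase _ _)
  have hupd : ∀ c, Function.update w₁ (Fin.last t) c =
      Function.update (1 : Fin (t + 1) → K) (Fin.last t) c := by
    intro c
    ext i
    rcases eq_or_ne i (Fin.last t) with rfl | hi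
    · simp
    · simp [hi, hone i (by simp [hi])]
  -- All norms but the last are now 1, and the last can still be changed by a square. Its square
  -- class decides between `1` and `r`.
  have hfinal : ∀ c d, c ^ 2 * w₁ (Fin.last t) = d → d ≠ 0 →
      ∃ U : GL (Fin (t + 1)) K, (U : Matrix _ _ K) * A * (U : Matrix _ _ K)ᵀ = signForm _ d := by
    intro c d hcd hd
    have h₂ := h₁.scale (Fin.last t) c
    rw [hcd, hupd] at h₂
    have h₃ := (hasGram_toBilin'_iff A (of (Function.update v₁ (Fin.last t)
      (c • v₁ (Fin.last t)))) _).mp h₂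
    rw [← signForm_succ] at h₃
    refine ⟨GeneralLinearGroup.mkOfDetNeZero _ fun h0 => hd ?_, h₃⟩
    rw [← det_signForm (t := t) d, ← h₃, det_mul, det_mul, h0, zero_mul, zero_mul]
  by_cases hsq : IsSquare (w₁ (Fin.last t))
  · obtain ⟨c, hc⟩ := hsq
    have hc0 : c ≠ 0 := by rintro rfl; exact hw₁ _ (by rw [hc, zero_mul])
    obtain ⟨U, hU⟩ := hfinal c⁻¹ 1 (by rw [hc]; field_simp) one_ne_zero
    exact ⟨U, Or.inl hU⟩
  · obtain ⟨c, hc⟩ := exists_eq_sq_mul_of_not_isSquare hsq hr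
    obtain ⟨U, hU⟩ := hfinal c r hc (by rintro rfl; exact hr IsSquare.zero)
    exact ⟨U, Or.inr hU⟩

/-- The action of `GL` on symmetric matrices by congruence. -/
instance congruenceAction : MulAction (GL ι K) {A : Matrix ι ι K // A.IsSymm} where
  smul U A := ⟨U * A.1 * (U : Matrix ι ι K)ᵀ, by
    rw [IsSymm, transpose_mul, transpose_mul, transpose_transpose, A.2.eq, Matrix.mul_assoc]⟩
  one_smul A := Subtype.ext (by
    change (1 : Matrix ι ι K) * A.1 * (1 : Matrix ι ι K)ᵀ = A.1
    simp)
  mul_smul U V A := Subtype.ext (by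
    change (U * V : Matrix ι ι K) * A.1 * (U * V : Matrix ι ι K)ᵀ =
      U * (V * A.1 * (V : Matrix ι ι K)ᵀ) * (U : Matrix ι ι K)ᵀ
    simp only [transpose_mul, Matrix.mul_assoc])

theorem coe_smul_symm (U : GL ι K) (A : {A : Matrix ι ι K // A.IsSymm}) :
    (U • A).1 = U * A.1 * (U : Matrix ι ι K)ᵀ := rfl

end Orthogonal

/-! ### Orbit counting and the orthogonal densities -/

section OrthogonalCount

variable (p : ℕ) [Fact p.Prime]

theorem card_orbit_mul_card_orthogonal (t : ℕ) (d : ZMod p) :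
    (Nat.card (MulAction.orbit (GL (Fin t) (ZMod p))
      (⟨signForm t d, signForm_isSymm t d⟩ : {A : Matrix (Fin t) (Fin t) (ZMod p) // A.IsSymm})) : ℝ)
      * (alphaDens p t d * (p : ℝ) ^ (t * (t - 1) / 2)) = piDens p t * (p : ℝ) ^ (t ^ 2) := by
  classical
  have hp : (p : ℝ) ≠ 0 := by exact_mod_cast (Fact.out : p.Prime).ne_zero
  have h := MulAction.card_orbit_mul_card_stabilizer_eq_card_group (GL (Fin t) (ZMod p))
    (⟨signForm t d, signForm_isSymm t d⟩ : {A : Matrix (Fin t) (Fin t) (ZMod p) // A.IsSymm})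
  simp only [← Nat.card_eq_fintype_card] at h
  have hs : Nat.card (MulAction.stabilizer (GL (Fin t) (ZMod p))
      (⟨signForm t d, signForm_isSymm t d⟩ : {A : Matrix (Fin t) (Fin t) (ZMod p) // A.IsSymm})) =
      Nat.card {U : GL (Fin t) (ZMod p) //
        (U : Matrix (Fin t) (Fin t) (ZMod p)) * signForm t d
          * (U : Matrix (Fin t) (Fin t) (ZMod p)).transpose = signForm t d} :=
    Nat.card_congr (Equiv.subtypeEquivRight fun U => by
      rw [MulAction.mem_stabilizer_iff, Subtype.ext_iff]; rfl)
  rw [alphaDens, piDens, ← hs, ← h]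
  push_cast
  field_simp

theorem alphaDens_pos (t : ℕ) (d : ZMod p) : 0 < alphaDens p t d := by
  have hp : 0 < (p : ℝ) := by exact_mod_cast (Fact.out : p.Prime).pos
  refine div_pos (Nat.cast_pos.mpr (Nat.card_pos_iff.mpr ⟨⟨⟨1, ?_⟩⟩, inferInstance⟩)) (by positivity)
  simp

theorem rankCount_eq_card_orbit_add (hp : p ≠ 2) (t : ℕ) (ht : 1 ≤ t) (r : ZMod p)
    (hr : ¬ IsSquare r) :
    rankCount p (Fin t) t =
      Nat.card (MulAction.orbit (GL (Fin t) (ZMod p))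
        (⟨signForm t 1, signForm_isSymm t 1⟩ :
          {A : Matrix (Fin t) (Fin t) (ZMod p) // A.IsSymm})) +
      Nat.card (MulAction.orbit (GL (Fin t) (ZMod p))
        (⟨signForm t r, signForm_isSymm t r⟩ :
          {A : Matrix (Fin t) (Fin t) (ZMod p) // A.IsSymm})) := by
  classical
  have hK : Fintype.card (ZMod p) % 2 = 1 := by
    rw [ZMod.card]; exact (Fact.out : p.Prime).eq_two_or_odd.resolve_left hp
  have hr0 : r ≠ 0 := by rintro rfl; exact hr IsSquare.zero
  have hdet : ∀ d : ZMod p, (signForm t d).det = d := by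
    obtain ⟨t, rfl⟩ : ∃ s, t = s + 1 := ⟨t - 1, by omega⟩
    exact fun d => det_signForm d
  rw [Nat.card_coe_set_eq, Nat.card_coe_set_eq, ← Set.ncard_union_eq, ← Nat.card_coe_set_eq,
    rankCount]
  · refine Nat.card_congr (Equiv.subtypeEquivRight fun A => ?_)
    have hcard : A.1.rank = t ↔ IsUnit A.1 := by
      rw [← rank_eq_card_iff_isUnit, Fintype.card_fin]
    rw [hcard]
    constructor
    · intro hA
      obtain ⟨U, hU | hU⟩ := exists_congruent_signForm hK ht hr A.1 A.2 hA
      · exact Or.inl (MulAction.mem_orbit_symm.mp ⟨U, Subtype.ext hU⟩)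
      · exact Or.inr (MulAction.mem_orbit_symm.mp ⟨U, Subtype.ext hU⟩)
    · have key : ∀ d : ZMod p, d ≠ 0 → ∀ U : GL (Fin t) (ZMod p),
          IsUnit ((U : Matrix _ _ (ZMod p)) * signForm t d * (U : Matrix _ _ (ZMod p))ᵀ) := by
        intro d hd U
        refine (U.isUnit.mul ?_).mul ((isUnit_transpose _).mpr U.isUnit)
        rw [isUnit_iff_isUnit_det, hdet]
        exact hd.isUnit
      rintro (⟨U, rfl⟩ | ⟨U, rfl⟩)
      · exact key 1 one_ne_zero U
      · exact key r hr0 U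
  -- The determinant modulo squares is invariant under congruence, so a common element of the orbits
  -- would make `r` a square.
  · rw [Set.disjoint_left]
    rintro A ⟨U, hU⟩ ⟨V, hV⟩
    have h := congrArg (fun B => B.1.det) (hU.trans hV.symm)
    simp only [coe_smul_symm, det_mul, det_transpose, hdet, mul_one] at h
    have hV0 : (V : Matrix (Fin t) (Fin t) (ZMod p)).det ≠ 0 :=
      ((isUnit_iff_isUnit_det _).mp V.isUnit).ne_zero
    refine hr ⟨(U : Matrix (Fin t) (Fin t) (ZMod p)).det / (V : Matrix (Fin t) (Fin t) (ZMod p)).det,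
      ?_⟩
    field_simp
    linear_combination -h

/-- With `P = p^{t(t+1)/2}`, there are `P π_t / β_t` invertible symmetric matrices, and the two
orbits have sizes `P π_t / α_t^±`. -/
theorem inv_betaDens_eq (hp : p ≠ 2) (t : ℕ) (ht : 1 ≤ t) (r : ZMod p) (hr : ¬ IsSquare r) :
    (betaDens p t)⁻¹ = (alphaDens p t 1)⁻¹ + (alphaDens p t r)⁻¹ := by
  have hp0 : (p : ℝ) ≠ 0 := by exact_mod_cast (Fact.out : p.Prime).ne_zero
  have h0 := rankCount_fin p t t 0 (by omega)
  rw [rankCount_eq_card_orbit_add p hp t ht r hr] at h0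
  have h1 := card_orbit_mul_card_orthogonal p t 1
  have h2 := card_orbit_mul_card_orthogonal p t r
  have ha1 := (alphaDens_pos p t 1).ne'
  have ha2 := (alphaDens_pos p t r).ne'
  have hb := (betaDens_pos p t).ne'
  have hpi := (piDens_pos p t).ne'
  push_cast at h0
  have hexp : (p : ℝ) ^ (t ^ 2) = (p : ℝ) ^ (t + 1).choose 2 * (p : ℝ) ^ (t * (t - 1) / 2) := by
    rw [← pow_add, Nat.choose_two_right, Nat.add_sub_cancel]
    congr 1
    obtain ⟨s, rfl⟩ : ∃ s, t = s + 1 := ⟨t - 1, by omega⟩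
    obtain ⟨c, hc⟩ := Nat.even_mul_succ_self s
    rw [Nat.add_sub_cancel, mul_comm (s + 1) s, hc,
      show (s + 1 + 1) * (s + 1) = (c + c) + 2 * (s + 1) by rw [← hc]; ring]
    rw [show (s + 1) ^ 2 = s * (s + 1) + (s + 1) by ring, hc]
    omega
  have hP : (p : ℝ) ^ (t + 1).choose 2 ≠ 0 := pow_ne_zero _ hp0
  have hQ : (p : ℝ) ^ (t * (t - 1) / 2) ≠ 0 := pow_ne_zero _ hp0
  rw [hexp] at h1 h2
  generalize (p : ℝ) ^ (t + 1).choose 2 = P at *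
  generalize (p : ℝ) ^ (t * (t - 1) / 2) = Q at *
  rw [piDens_zero] at h0
  rw [← eq_div_iff (mul_ne_zero ha1 hQ)] at h1
  rw [← eq_div_iff (mul_ne_zero ha2 hQ)] at h2
  rw [h1, h2] at h0
  simp at h0
  field_simp at h0 ⊢
  linear_combination -h0

end OrthogonalCount

end PadicSym

namespace PadicSym

open Matrix

/-! ### Splitting off the kernel of a symmetric matrix -/

section KernelBasis

variable {K : Type*} [Field K] {α β : Type*} [Fintype α] [Fintype β] [DecidableEq α]
  [DecidableEq β]

/-- A symmetric matrix is congruent to an invertible block bordered by zeros. -/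
theorem exists_congruent_fromBlocks (A : Matrix (α ⊕ β) (α ⊕ β) K) (hA : A.IsSymm)
    (hr : A.rank = Fintype.card α) :
    ∃ (U : GL (α ⊕ β) K) (A' : Matrix α α K), IsUnit A' ∧
      (U : Matrix (α ⊕ β) (α ⊕ β) K) * A * (U : Matrix (α ⊕ β) (α ⊕ β) K)ᵀ =
        fromBlocks A' 0 0 0 := by
  let N := LinearMap.ker A.mulVecLin
  obtain ⟨C, hC⟩ := N.exists_isCompl
  have hN : Module.finrank K N = Fintype.card β := by
    have h := A.mulVecLin.finrank_range_add_finrank_ker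
    rw [Module.finrank_fintype_fun_eq_card, Fintype.card_sum] at h
    have hr' : Module.finrank K (LinearMap.range A.mulVecLin) = Fintype.card α := hr
    simp only [N]
    omega
  have hC' : Module.finrank K C = Fintype.card α := by
    have h := Submodule.finrank_add_eq_of_isCompl hC
    rw [Module.finrank_fintype_fun_eq_card, Fintype.card_sum] at h
    omega
  let bN : Module.Basis β K N := (Module.finBasisOfFinrankEq K N hN).reindex
    (Fintype.equivFin β).symm
  let bC : Module.Basis α K C := (Module.finBasisOfFinrankEq K C hC').reindex
    (Fintype.equivFin α).symm
  -- The rows of `U` are a basis of a complement of the kernel followed by a basis of the kernel.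
  -- The latter gives zero columns, and symmetry gives zero rows.
  let b : Module.Basis (α ⊕ β) K (α ⊕ β → K) :=
    (bC.prod bN).map (Submodule.prodEquivOfIsCompl C N hC.symm)
  have hb : ∀ j, A *ᵥ b (Sum.inr j) = 0 := by
    intro j
    have h : b (Sum.inr j) = bN j := by simp [b]
    rw [h]
    exact LinearMap.mem_ker.mp (bN j).2
  have hunit : IsUnit (of b : Matrix (α ⊕ β) (α ⊕ β) K) :=
    linearIndependent_rows_iff_isUnit.mp b.linearIndependent
  obtain ⟨U, hU⟩ := hunit
  have hz : ∀ i j, ((of b : Matrix (α ⊕ β) (α ⊕ β) K) * A * (of b)ᵀ) i (Sum.inr j) = 0 := by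
    intro i j
    rw [mul_mul_apply]
    have : ((of b : Matrix (α ⊕ β) (α ⊕ β) K)ᵀ)ᵀ (Sum.inr j) = b (Sum.inr j) := rfl
    rw [this, hb, dotProduct_zero]
  have hS : ((of b : Matrix (α ⊕ β) (α ⊕ β) K) * A * (of b)ᵀ).IsSymm := by
    rw [IsSymm, transpose_mul, transpose_mul, transpose_transpose, hA.eq, Matrix.mul_assoc]
  have heq : (of b : Matrix (α ⊕ β) (α ⊕ β) K) * A * (of b)ᵀ =
      fromBlocks ((of b : Matrix (α ⊕ β) (α ⊕ β) K) * A * (of b)ᵀ).toBlocks₁₁ 0 0 0 := by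
    ext (i | i) (j | j)
    · rfl
    · exact hz _ _
    · rw [← hS.apply]; exact hz _ _
    · exact hz _ _
  refine ⟨U, _, ?_, by rw [hU]; exact heq⟩
  generalize ((of b : Matrix (α ⊕ β) (α ⊕ β) K) * A * (of b)ᵀ).toBlocks₁₁ = A' at heq
  rw [← rank_eq_card_iff_isUnit]
  refine le_antisymm (rank_le_card_width _) ?_
  have hrank : ((of b : Matrix (α ⊕ β) (α ⊕ β) K) * A * (of b)ᵀ).rank = Fintype.card α := by
    rw [← hU, rank_mul_eq_left_of_isUnit_det, rank_mul_eq_right_of_isUnit_det, hr]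
    · exact (isUnit_iff_isUnit_det _).mp U.isUnit
    · exact (isUnit_iff_isUnit_det _).mp ((isUnit_transpose _).mpr U.isUnit)
  -- Factoring through `A'` bounds the whole rank by that of `A'`, so `A'` has full rank.
  have hfac : (fromBlocks A' 0 0 0 : Matrix (α ⊕ β) (α ⊕ β) K) =
      fromRows (1 : Matrix α α K) 0 * (A' * fromCols (1 : Matrix α α K) 0) := by
    rw [mul_fromCols, fromRows_mul, Matrix.mul_one, Matrix.mul_zero, Matrix.one_mul,
      Matrix.zero_mul]
    ext (i | i) (j | j) <;> simp
  rw [← hrank, heq, hfac]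
  exact (rank_mul_le_right _ _).trans (rank_mul_le_left _ _)

end KernelBasis

/-! ### Reduction modulo `p` -/

section Residue

variable (p : ℕ) [Fact p.Prime]

theorem isUnit_iff_toZMod_ne_zero (x : ℤ_[p]) : IsUnit x ↔ PadicInt.toZMod x ≠ 0 := by
  rw [Ne, ← RingHom.mem_ker, PadicInt.ker_toZMod, IsLocalRing.mem_maximalIdeal, mem_nonunits_iff,
    not_not]

theorem toZMod_eq_zero_iff (x : ℤ_[p]) : PadicInt.toZMod x = 0 ↔ ∃ y, x = p * y := by
  rw [← RingHom.mem_ker, PadicInt.ker_toZMod, PadicInt.maximalIdeal_eq_span_p,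
    Ideal.mem_span_singleton]
  rfl

variable {p} {ι : Type*} [Fintype ι] [DecidableEq ι]

theorem isUnit_iff_isUnit_map_toZMod (M : Matrix ι ι ℤ_[p]) :
    IsUnit M ↔ IsUnit (M.map PadicInt.toZMod) := by
  rw [isUnit_iff_isUnit_det, isUnit_iff_isUnit_det, isUnit_iff_toZMod_ne_zero, RingHom.map_det,
    isUnit_iff_ne_zero]
  rfl

theorem map_toZMod_smul {γ δ : Type*} (N : Matrix γ δ ℤ_[p]) :
    ((p : ℤ_[p]) • N).map PadicInt.toZMod = 0 := by
  ext i j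
  simp

theorem exists_lift_GL (U : GL ι (ZMod p)) : ∃ V : GL ι ℤ_[p],
    (V : Matrix ι ι ℤ_[p]).map PadicInt.toZMod = (U : Matrix ι ι (ZMod p)) := by
  choose s hs using ZMod.ringHom_surjective (PadicInt.toZMod (p := p))
  have hmap : ((U : Matrix ι ι (ZMod p)).map s).map PadicInt.toZMod = U := by
    ext i j; exact hs _
  have hu : IsUnit ((U : Matrix ι ι (ZMod p)).map s) := by
    rw [isUnit_iff_isUnit_map_toZMod, hmap]; exact U.isUnit
  obtain ⟨V, hV⟩ := hu
  exact ⟨V, by rw [hV, hmap]⟩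

end Residue

/-! ### Elementary divisors and Schur complements -/

section SmithClass

variable {p : ℕ} [Fact p.Prime] {ι : Type*} [Fintype ι] [DecidableEq ι]

/-- The matrices with elementary divisors `p ^ k i`, for an arbitrary finite index type. -/
def smithClass (k : ι → ℕ) : Set (Matrix ι ι ℤ_[p]) :=
  {M | ∃ U V : GL ι ℤ_[p], M = (U : Matrix ι ι ℤ_[p]) * diagonal (fun i => (p : ℤ_[p]) ^ k i) * V}

theorem mul_mul_mem_smithClass {k : ι → ℕ} {M : Matrix ι ι ℤ_[p]} (U V : GL ι ℤ_[p])
    (hM : M ∈ smithClass k) : (U : Matrix ι ι ℤ_[p]) * M * V ∈ smithClass k := by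
  obtain ⟨P, Q, rfl⟩ := hM
  exact ⟨U * P, Q * V, by simp only [Units.val_mul, Matrix.mul_assoc]⟩

theorem mul_mul_mem_smithClass_iff {k : ι → ℕ} {M : Matrix ι ι ℤ_[p]} (U V : GL ι ℤ_[p]) :
    (U : Matrix ι ι ℤ_[p]) * M * V ∈ smithClass k ↔ M ∈ smithClass k := by
  refine ⟨fun h => ?_, mul_mul_mem_smithClass U V⟩
  have := mul_mul_mem_smithClass U⁻¹ V⁻¹ h
  rwa [Matrix.mul_assoc, Matrix.mul_assoc, Units.mul_inv, Matrix.mul_one, ← Matrix.mul_assoc,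
    Units.inv_mul, Matrix.one_mul] at this

theorem mul_mul_mem_smithClass_iff' {k : ι → ℕ} {M U V : Matrix ι ι ℤ_[p]} (hU : IsUnit U)
    (hV : IsUnit V) : U * M * V ∈ smithClass k ↔ M ∈ smithClass k := by
  obtain ⟨U, rfl⟩ := hU
  obtain ⟨V, rfl⟩ := hV
  exact mul_mul_mem_smithClass_iff U V

theorem submatrix_mem_smithClass {κ : Type*} [Fintype κ] [DecidableEq κ] (e : κ ≃ ι) {k : ι → ℕ}
    {M : Matrix ι ι ℤ_[p]} (hM : M ∈ smithClass k) : M.submatrix e e ∈ smithClass (k ∘ e) := by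
  obtain ⟨U, V, rfl⟩ := hM
  have h : ∀ W : GL ι ℤ_[p], IsUnit ((W : Matrix ι ι ℤ_[p]).submatrix e e) := fun W =>
    (isUnit_submatrix_equiv e e).mpr W.isUnit
  refine ⟨(h U).unit, (h V).unit, ?_⟩
  rw [IsUnit.unit_spec, IsUnit.unit_spec, ← submatrix_mul_equiv _ _ e e e,
    ← submatrix_mul_equiv _ _ e e e]
  congr 2
  exact submatrix_diagonal_equiv (fun i => (p : ℤ_[p]) ^ k i) e

theorem submatrix_mem_smithClass_iff {κ : Type*} [Fintype κ] [DecidableEq κ] (e : κ ≃ ι)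
    {k : ι → ℕ} {M : Matrix ι ι ℤ_[p]} :
    M.submatrix e e ∈ smithClass (k ∘ e) ↔ M ∈ smithClass k := by
  refine ⟨fun h => ?_, submatrix_mem_smithClass e⟩
  have := submatrix_mem_smithClass e.symm h
  rw [submatrix_submatrix, Function.comp_assoc, e.self_comp_symm, submatrix_id_id] at this
  exact this

theorem rank_map_toZMod_of_mem_smithClass {k : ι → ℕ} {M : Matrix ι ι ℤ_[p]}
    (hM : M ∈ smithClass k) :
    (M.map PadicInt.toZMod).rank = Fintype.card {i // k i = 0} := by
  obtain ⟨U, V, rfl⟩ := hM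
  have h : ∀ W : GL ι ℤ_[p], IsUnit ((W : Matrix ι ι ℤ_[p]).map PadicInt.toZMod).det := fun W => by
    rw [← isUnit_iff_isUnit_det, ← isUnit_iff_isUnit_map_toZMod]; exact W.isUnit
  rw [Matrix.map_mul, Matrix.map_mul, rank_mul_eq_left_of_isUnit_det _ _ (h V),
    rank_mul_eq_right_of_isUnit_det _ _ (h U), diagonal_map (map_zero _), rank_diagonal]
  refine Fintype.card_congr (Equiv.subtypeEquivRight fun i => ?_)
  by_cases hk : k i = 0 <;> simp [hk]

variable {α β : Type*} [Fintype α] [Fintype β] [DecidableEq α] [DecidableEq β]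

set_option linter.unusedSectionVars false in
theorem diagonal_sumElim_succ (k : β → ℕ) :
    diagonal (fun i => (p : ℤ_[p]) ^ (Sum.elim (0 : α → ℕ) (fun j => k j + 1)) i) =
      fromBlocks 1 0 0 ((p : ℤ_[p]) • diagonal fun j => (p : ℤ_[p]) ^ k j) := by
  ext (i | i) (j | j)
  · simp [diagonal_apply, one_apply]
  · simp
  · simp
  · simp [diagonal_apply, pow_succ']

/-- Uniqueness of elementary divisors, peeling off the unit ones. -/
theorem fromBlocks_one_mem_smithClass_iff (k : β → ℕ) (W : Matrix β β ℤ_[p]) :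
    (fromBlocks 1 0 0 ((p : ℤ_[p]) • W) : Matrix (α ⊕ β) (α ⊕ β) ℤ_[p]) ∈
      smithClass (Sum.elim (0 : α → ℕ) (fun j => k j + 1)) ↔ W ∈ smithClass k := by
  have hp0 : (p : ℤ_[p]) ≠ 0 := by exact_mod_cast (Fact.out : p.Prime).ne_zero
  constructor
  · rintro ⟨U, V, h⟩
    rw [diagonal_sumElim_succ] at h
    set D := diagonal fun j => (p : ℤ_[p]) ^ k j with hD
    have h' : (↑U⁻¹ : Matrix (α ⊕ β) (α ⊕ β) ℤ_[p]) * fromBlocks 1 0 0 ((p : ℤ_[p]) • W) =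
        (fromBlocks 1 0 0 ((p : ℤ_[p]) • D) : Matrix (α ⊕ β) (α ⊕ β) ℤ_[p]) *
          (V : Matrix (α ⊕ β) (α ⊕ β) ℤ_[p]) := by
      rw [h, Matrix.mul_assoc, ← Matrix.mul_assoc, Units.inv_mul, Matrix.one_mul]
    have hPu : IsUnit (↑U⁻¹ : Matrix (α ⊕ β) (α ⊕ β) ℤ_[p]) := (U⁻¹).isUnit
    have hVu : IsUnit (V : Matrix (α ⊕ β) (α ⊕ β) ℤ_[p]) := V.isUnit
    generalize (↑U⁻¹ : Matrix (α ⊕ β) (α ⊕ β) ℤ_[p]) = P at h' hPu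
    generalize (V : Matrix (α ⊕ β) (α ⊕ β) ℤ_[p]) = Q at h' hVu
    rw [← fromBlocks_toBlocks P, ← fromBlocks_toBlocks Q] at h'
    simp only [fromBlocks_multiply, Matrix.mul_zero, Matrix.mul_one, Matrix.zero_mul,
      Matrix.one_mul, add_zero, zero_add, fromBlocks_inj, Matrix.smul_mul, Matrix.mul_smul] at h'
    obtain ⟨-, h12, h21, h22⟩ := h'
    -- Off-diagonal blocks show that modulo `p` the matrix `P` is block upper triangular and `Q`
    -- block lower triangular, so their lower right blocks are invertible. Cancelling `p` in the
    -- remaining block then relates `W` to `D`.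
    have hP22 : IsUnit P.toBlocks₂₂ := by
      rw [isUnit_iff_isUnit_map_toZMod, ← fromBlocks_toBlocks P, fromBlocks_map, h21, map_toZMod_smul,
        isUnit_iff_isUnit_det, det_fromBlocks_zero₂₁] at hPu
      rw [isUnit_iff_isUnit_map_toZMod, isUnit_iff_isUnit_det]
      exact isUnit_of_mul_isUnit_right hPu
    have hQ22 : IsUnit Q.toBlocks₂₂ := by
      rw [isUnit_iff_isUnit_map_toZMod, ← fromBlocks_toBlocks Q, fromBlocks_map, ← h12, map_toZMod_smul,
        isUnit_iff_isUnit_det, det_fromBlocks_zero₁₂] at hVu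
      rw [isUnit_iff_isUnit_map_toZMod, isUnit_iff_isUnit_det]
      exact isUnit_of_mul_isUnit_right hVu
    have hW : P.toBlocks₂₂ * W = D * Q.toBlocks₂₂ := by
      ext i j
      have := congrFun (congrFun h22 i) j
      simp only [Matrix.smul_apply, smul_eq_mul] at this
      exact mul_left_cancel₀ hp0 this
    obtain ⟨P', hP'⟩ := hP22
    obtain ⟨Q', hQ'⟩ := hQ22
    refine ⟨P'⁻¹, Q', ?_⟩
    rw [Matrix.mul_assoc, hQ', ← hW, ← hP', ← Matrix.mul_assoc, Units.inv_mul, Matrix.one_mul]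
  · rintro ⟨U, V, rfl⟩
    have hu : ∀ X : GL β ℤ_[p],
        IsUnit (fromBlocks 1 0 0 (X : Matrix β β ℤ_[p]) : Matrix (α ⊕ β) (α ⊕ β) ℤ_[p]) := by
      intro X
      rw [isUnit_iff_isUnit_det, det_fromBlocks_zero₂₁, det_one, one_mul, ← isUnit_iff_isUnit_det]
      exact X.isUnit
    refine ⟨(hu U).unit, (hu V).unit, ?_⟩
    rw [diagonal_sumElim_succ, IsUnit.unit_spec, IsUnit.unit_spec]
    simp [fromBlocks_multiply]

/-- Elementary divisors of a block matrix through its Schur complement. -/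
theorem fromBlocks_mem_smithClass_iff (k : β → ℕ) {A : Matrix α α ℤ_[p]} (hA : IsUnit A)
    (B : Matrix α β ℤ_[p]) (C : Matrix β α ℤ_[p]) (Z : Matrix β β ℤ_[p]) :
    fromBlocks A ((p : ℤ_[p]) • B) ((p : ℤ_[p]) • C) ((p : ℤ_[p]) • Z) ∈
      smithClass (Sum.elim (0 : α → ℕ) (fun j => k j + 1)) ↔
    Z - (p : ℤ_[p]) • (C * A⁻¹ * B) ∈ smithClass k := by
  obtain ⟨_⟩ := hA.nonempty_invertible
  rw [← fromBlocks_one_mem_smithClass_iff (α := α) k, fromBlocks_eq_of_invertible₁₁ A]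
  have hl : IsUnit (fromBlocks 1 0 (((p : ℤ_[p]) • C) * ⅟A) 1 : Matrix (α ⊕ β) (α ⊕ β) ℤ_[p]) := by
    rw [isUnit_iff_isUnit_det, det_fromBlocks_zero₁₂, det_one, det_one, one_mul]; exact isUnit_one
  have hr : IsUnit (fromBlocks 1 (⅟A * ((p : ℤ_[p]) • B)) 0 1 : Matrix (α ⊕ β) (α ⊕ β) ℤ_[p]) := by
    rw [isUnit_iff_isUnit_det, det_fromBlocks_zero₂₁, det_one, det_one, one_mul]; exact isUnit_one
  have hm : IsUnit (fromBlocks A 0 0 1 : Matrix (α ⊕ β) (α ⊕ β) ℤ_[p]) := by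
    rw [isUnit_iff_isUnit_det, det_fromBlocks_zero₂₁, det_one, mul_one, ← isUnit_iff_isUnit_det]
    exact hA
  have hfac : ∀ S : Matrix β β ℤ_[p], (fromBlocks A 0 0 S : Matrix (α ⊕ β) (α ⊕ β) ℤ_[p]) =
      fromBlocks A 0 0 1 * fromBlocks 1 0 0 S * 1 := fun S => by simp [fromBlocks_multiply]
  rw [mul_mul_mem_smithClass_iff' hl hr, hfac, mul_mul_mem_smithClass_iff' hm isUnit_one,
    invOf_eq_nonsing_inv]
  simp [smul_sub]

end SmithClass

end PadicSym

namespace PadicSym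

open Matrix MeasureTheory

/-! ### Symmetric matrices as functions on unordered pairs -/

section SymMat

variable {ι R : Type*}

/-- The symmetric matrix with the given entries. -/
def symMat (y : Sym2 ι → R) : Matrix ι ι R := of fun i j => y s(i, j)

@[simp]
theorem symMat_apply (y : Sym2 ι → R) (i j : ι) : symMat y i j = y s(i, j) := rfl

theorem symMat_isSymm (y : Sym2 ι → R) : (symMat y).IsSymm := by
  ext i j
  simp [Sym2.eq_swap]

/-- The entries of a symmetric matrix. -/
def symEntries (M : Matrix ι ι R) (hM : M.IsSymm) : Sym2 ι → R :=
  Sym2.lift ⟨fun i j => M i j, fun i j => hM.apply j i⟩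

@[simp]
theorem symMat_symEntries (M : Matrix ι ι R) (hM : M.IsSymm) : symMat (symEntries M hM) = M := rfl

theorem symMat_injective : Function.Injective (symMat : (Sym2 ι → R) → Matrix ι ι R) := by
  intro y z h
  ext e
  induction e with
  | _ i j => exact congrFun (congrFun h i) j

/-- Symmetric matrices are determined by their entries at unordered pairs. -/
def symMatEquiv (ι R : Type*) : (Sym2 ι → R) ≃ {M : Matrix ι ι R // M.IsSymm} where
  toFun y := ⟨symMat y, symMat_isSymm y⟩
  invFun M := symEntries M.1 M.2
  left_inv _ := symMat_injective rfl
  right_inv _ := rfl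

variable [CommRing R]

theorem symMat_add (y z : Sym2 ι → R) : symMat (y + z) = symMat y + symMat z := rfl

theorem symMat_smul (c : R) (y : Sym2 ι → R) : symMat (c • y) = c • symMat y := rfl

variable [Fintype ι]

theorem isSymm_mul_mul_transpose {κ : Type*} (U : Matrix κ ι R) {M : Matrix ι ι R}
    (hM : M.IsSymm) : (U * M * Uᵀ).IsSymm := by
  rw [IsSymm, transpose_mul, transpose_mul, transpose_transpose, hM.eq, Matrix.mul_assoc]

/-- The transformation `M ↦ U M Uᵀ` of symmetric matrices. -/
def congruence (U : Matrix ι ι R) : (Sym2 ι → R) →+ (Sym2 ι → R) where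
  toFun y := symEntries (U * symMat y * Uᵀ) (isSymm_mul_mul_transpose U (symMat_isSymm y))
  map_zero' := symMat_injective (by
    change U * symMat 0 * Uᵀ = 0
    rw [show symMat (0 : Sym2 ι → R) = 0 from rfl, Matrix.mul_zero, Matrix.zero_mul])
  map_add' y z := symMat_injective (by
    change U * symMat (y + z) * Uᵀ = U * symMat y * Uᵀ + U * symMat z * Uᵀ
    rw [symMat_add, Matrix.mul_add, Matrix.add_mul])

@[simp]
theorem symMat_congruence (U : Matrix ι ι R) (y : Sym2 ι → R) :
    symMat (congruence U y) = U * symMat y * Uᵀ := rfl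

theorem congruence_smul (U : Matrix ι ι R) (c : R) (y : Sym2 ι → R) :
    congruence U (c • y) = c • congruence U y :=
  symMat_injective (by simp [symMat_smul])

theorem congruence_surjective [DecidableEq ι] (U : GL ι R) :
    Function.Surjective (congruence (U : Matrix ι ι R)) := by
  intro y
  refine ⟨congruence (↑U⁻¹ : Matrix ι ι R) y, symMat_injective ?_⟩
  rw [symMat_congruence, symMat_congruence]
  calc (U : Matrix ι ι R) * (↑U⁻¹ * symMat y * (↑U⁻¹ : Matrix ι ι R)ᵀ) * (U : Matrix ι ι R)ᵀ
      = (U * ↑U⁻¹ : Matrix ι ι R) * symMat y * (U * ↑U⁻¹ : Matrix ι ι R)ᵀ := by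
        simp only [transpose_mul, Matrix.mul_assoc]
    _ = symMat y := by rw [Units.mul_inv]; simp

end SymMat

/-! ### Haar measure on `p`-adic vectors -/

section Haar

variable (p : ℕ) [Fact p.Prime] [MeasurableSpace ℤ_[p]] [BorelSpace ℤ_[p]]

instance haar_isAddHaarMeasure : (haar p).IsAddHaarMeasure := by
  unfold haar; infer_instance

instance haar_isProbabilityMeasure : IsProbabilityMeasure (haar p) :=
  ⟨by simpa [haar] using Measure.addHaarMeasure_self (K₀ := (⊤ : TopologicalSpace.PositiveCompacts ℤ_[p]))⟩

/-- Haar measure on the space of `p`-adic vectors. -/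
noncomputable def piHaar (κ : Type*) [Fintype κ] : Measure (κ → ℤ_[p]) := Measure.pi fun _ => haar p

variable {κ : Type*} [Fintype κ]

instance piHaar_isAddHaarMeasure : (piHaar p κ).IsAddHaarMeasure := by
  unfold piHaar; infer_instance

instance piHaar_isProbabilityMeasure : IsProbabilityMeasure (piHaar p κ) := by
  unfold piHaar; infer_instance

variable {p}

theorem eq_piHaar_of_isAddLeftInvariant (ν : Measure (κ → ℤ_[p])) [IsFiniteMeasure ν]
    [ν.IsAddLeftInvariant] : ν = ν Set.univ • piHaar p κ := by
  have h := Measure.isAddLeftInvariant_eq_smul ν (piHaar p κ)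
  have hu : ν Set.univ = ν.addHaarScalarFactor (piHaar p κ) := by
    conv_lhs => rw [h]
    simp
  rw [hu]
  exact h

/-- If `a - a' = p w`, changing the representative amounts to translating `y` by `w`, which Haar
measure does not see. -/
theorem smul_add_preimage (a a' : κ → ℤ_[p])
    (h : ∀ i, PadicInt.toZMod (a i) = PadicInt.toZMod (a' i)) (B : Set (κ → ℤ_[p])) :
    piHaar p κ {y | a + (p : ℤ_[p]) • y ∈ B} = piHaar p κ {y | a' + (p : ℤ_[p]) • y ∈ B} := by
  have hw : ∀ i, ∃ w, a i - a' i = p * w := fun i => by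
    rw [← toZMod_eq_zero_iff, map_sub, h, sub_self]
  choose w hw using hw
  rw [← measure_preimage_add (piHaar p κ) w {y | a' + (p : ℤ_[p]) • y ∈ B}]
  congr 1
  ext y
  have : a + (p : ℤ_[p]) • y = a' + (p : ℤ_[p]) • (w + y) := by
    ext i
    simp only [Pi.add_apply, Pi.smul_apply, smul_eq_mul]
    linear_combination hw i
  simp only [Set.mem_ofPred_eq, Set.mem_preimage, this]

/-- Disintegration of Haar measure over the residues modulo `p`. -/
theorem card_mul_piHaar [DecidableEq κ] (s : ZMod p → ℤ_[p])
    (hs : ∀ x, PadicInt.toZMod (s x) = x)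
    {B : Set (κ → ℤ_[p])} (hB : MeasurableSet B) :
    (p : ENNReal) ^ Fintype.card κ * piHaar p κ B =
      ∑ A : κ → ZMod p, piHaar p κ {y | s ∘ A + (p : ℤ_[p]) • y ∈ B} := by
  have hcont : ∀ a : κ → ℤ_[p], Measurable fun y : κ → ℤ_[p] => a + (p : ℤ_[p]) • y := fun a =>
    (show Continuous fun y : κ → ℤ_[p] => a + (p : ℤ_[p]) • y by fun_prop).measurable
  let ν : Measure (κ → ℤ_[p]) :=
    ∑ A : κ → ZMod p, (piHaar p κ).map fun y => s ∘ A + (p : ℤ_[p]) • y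
  have hν : ∀ C, MeasurableSet C →
      ν C = ∑ A : κ → ZMod p, piHaar p κ {y | s ∘ A + (p : ℤ_[p]) • y ∈ C} := by
    intro C hC
    simp only [ν, Measure.coe_finsetSum, Finset.sum_apply]
    refine Finset.sum_congr rfl fun A _ => ?_
    rw [Measure.map_apply (hcont _) hC]
    rfl
  have huniv : ν Set.univ = (p : ENNReal) ^ Fintype.card κ := by
    rw [hν _ MeasurableSet.univ]
    simp [ZMod.card]
  have : IsFiniteMeasure ν := ⟨by rw [huniv]; exact ENNReal.pow_lt_top (ENNReal.natCast_lt_top p)⟩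
  -- Translation by `c` permutes the residue classes; `smul_add_preimage` absorbs the change of
  -- representatives. By uniqueness `ν` is then its total mass times Haar.
  have : ν.IsAddLeftInvariant := ⟨fun c => by
    ext C hC
    rw [Measure.map_apply (measurable_const_add c) hC, hν _ hC,
      hν _ (measurable_const_add c hC)]
    rw [← Equiv.sum_comp (Equiv.addLeft (fun i => PadicInt.toZMod (c i)))
      (fun A => piHaar p κ {y | s ∘ A + (p : ℤ_[p]) • y ∈ C})]
    refine Finset.sum_congr rfl fun A _ => ?_
    refine Eq.trans ?_ (smul_add_preimage (c + s ∘ A) _ (fun i => ?_) C)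
    · simp only [add_assoc]
      rfl
    · simp [hs]⟩
  rw [← hν _ hB, eq_piHaar_of_isAddLeftInvariant ν, Measure.smul_apply, huniv, smul_eq_mul]

/-- A map that is equivariant for translations carries Haar measure to Haar measure. -/
theorem measurePreserving_of_equivariant {κ' : Type*} [Fintype κ']
    (T : (κ → ℤ_[p]) → (κ' → ℤ_[p])) (hT : Measurable T) (j : (κ' → ℤ_[p]) → (κ → ℤ_[p]))
    (hj : ∀ z y, T (j z + y) = z + T y) : MeasurePreserving T (piHaar p κ) (piHaar p κ') := by
  refine ⟨hT, ?_⟩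
  have : IsProbabilityMeasure ((piHaar p κ).map T) := Measure.isProbabilityMeasure_map hT.aemeasurable
  have : ((piHaar p κ).map T).IsAddLeftInvariant := ⟨fun z => by
    rw [Measure.map_map (measurable_const_add z) hT]
    have h : (fun x => z + x) ∘ T = T ∘ fun y => j z + y := by
      ext1 y
      exact (hj z y).symm
    rw [h, ← Measure.map_map hT (measurable_const_add _), map_add_left_eq_self]⟩
  rw [eq_piHaar_of_isAddLeftInvariant ((piHaar p κ).map T), measure_univ, one_smul]

/-- A continuous surjective endomorphism of a compact group preserves its Haar probability, so no
Jacobian is needed. -/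
theorem measurePreserving_congruence {ι : Type*} [Fintype ι] [DecidableEq ι] (U : GL ι ℤ_[p]) :
    MeasurePreserving (congruence (U : Matrix ι ι ℤ_[p])) (piHaar p (Sym2 ι))
      (piHaar p (Sym2 ι)) := by
  refine AddMonoidHom.measurePreserving ?_ (congruence_surjective U) rfl
  refine continuous_pi fun e => ?_
  induction e with
  | _ i j =>
    change Continuous fun y : Sym2 ι → ℤ_[p] =>
      ((U : Matrix ι ι ℤ_[p]) * symMat y * (U : Matrix ι ι ℤ_[p])ᵀ) i j
    simp only [mul_apply, symMat_apply]
    fun_prop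

end Haar

/-! ### Closedness of the double cosets -/

section Topology

variable {p : ℕ} [Fact p.Prime] {ι : Type*} [Fintype ι] [DecidableEq ι]

theorem isCompact_setOf_isUnit : IsCompact {U : Matrix ι ι ℤ_[p] | IsUnit U} := by
  have : CompactSpace (Matrix ι ι ℤ_[p]) := inferInstanceAs (CompactSpace (ι → ι → ℤ_[p]))
  have h : {U : Matrix ι ι ℤ_[p] | IsUnit U} = {U | ‖U.det‖ = 1} := by
    ext U
    rw [Set.mem_ofPred_eq, isUnit_iff_isUnit_det, PadicInt.isUnit_iff]
    rfl
  rw [h]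
  exact (isClosed_eq (continuous_norm.comp (continuous_id.matrix_det)) continuous_const).isCompact

/-- A double coset is the continuous image of a product of two copies of the compact group `GL`.
Measurability of the event comes from here. -/
theorem isClosed_smithClass (k : ι → ℕ) : IsClosed (smithClass (p := p) k) := by
  have h : smithClass (p := p) k =
      (fun UV : Matrix ι ι ℤ_[p] × Matrix ι ι ℤ_[p] =>
        UV.1 * diagonal (fun i => (p : ℤ_[p]) ^ k i) * UV.2) ''
        ({U | IsUnit U} ×ˢ {V | IsUnit V}) := by
    ext M
    constructor
    · rintro ⟨U, V, rfl⟩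
      exact ⟨(U, V), ⟨U.isUnit, V.isUnit⟩, rfl⟩
    · rintro ⟨⟨_, _⟩, ⟨⟨U, rfl⟩, ⟨V, rfl⟩⟩, rfl⟩
      exact ⟨U, V, rfl⟩
  rw [h]
  refine ((isCompact_setOf_isUnit.prod isCompact_setOf_isUnit).image ?_).isClosed
  fun_prop

set_option linter.unusedSectionVars false in
theorem continuous_symMat : Continuous (symMat : (Sym2 ι → ℤ_[p]) → Matrix ι ι ℤ_[p]) :=
  continuous_matrix fun i j => continuous_apply s(i, j)

theorem continuous_matrix_inv {X : Type*} [TopologicalSpace X] {f : X → Matrix ι ι ℤ_[p]}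
    (hf : Continuous f) (hu : ∀ x, IsUnit (f x)) : Continuous fun x => (f x)⁻¹ := by
  simp only [Matrix.inv_def]
  refine Continuous.smul (f := fun x => Ring.inverse (f x).det) ?_ hf.matrix_adjugate
  rw [continuous_iff_continuousAt]
  intro x
  obtain ⟨u, hu⟩ := (isUnit_iff_isUnit_det _).mp (hu x)
  refine ContinuousAt.comp (g := Ring.inverse) ?_ hf.matrix_det.continuousAt
  rw [← hu]
  exact NormedRing.inverse_continuousAt u

/-- The vectors of entries of symmetric matrices with elementary divisors `p ^ k i`. -/
def smithSet (p : ℕ) [Fact p.Prime] (k : ι → ℕ) : Set (Sym2 ι → ℤ_[p]) :=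
  {y | symMat y ∈ smithClass k}

theorem measurableSet_smithSet [MeasurableSpace ℤ_[p]] [BorelSpace ℤ_[p]] (k : ι → ℕ) :
    MeasurableSet (smithSet p k) :=
  ((isClosed_smithClass k).preimage continuous_symMat).measurableSet

end Topology

end PadicSym

namespace PadicSym

open Matrix MeasureTheory

/-! ### The recursion for the law of the elementary divisors -/

section Recursion

variable {p : ℕ} [Fact p.Prime] [MeasurableSpace ℤ_[p]] [BorelSpace ℤ_[p]]
  {α β : Type*} [Fintype α] [Fintype β] [DecidableEq α] [DecidableEq β]

/-- Perturbing an invertible block by `p` times a Haar matrix leaves, after splitting off the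
invertible block, `p` times a Haar matrix. -/
theorem piHaar_fromBlocks_add (k : β → ℕ) (A : Matrix α α ℤ_[p]) (hA : A.IsSymm) (hu : IsUnit A)
    (a : Sym2 (α ⊕ β) → ℤ_[p]) (ha : symMat a = fromBlocks A 0 0 0) :
    piHaar p (Sym2 (α ⊕ β))
      {y | a + (p : ℤ_[p]) • y ∈ smithSet p (Sum.elim (0 : α → ℕ) fun j => k j + 1)} =
    piHaar p (Sym2 β) (smithSet p k) := by
  -- The upper left block of `a + p y`, invertible because its residue is that of `A`.
  let M : (Sym2 (α ⊕ β) → ℤ_[p]) → Matrix α α ℤ_[p] := fun y =>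
    A + (p : ℤ_[p]) • (symMat y).toBlocks₁₁
  have hM : ∀ y, IsUnit (M y) := fun y => by
    rw [isUnit_iff_isUnit_map_toZMod] at hu ⊢
    rwa [Matrix.map_add _ (map_add _), map_toZMod_smul, add_zero]
  have hblock : ∀ y : Sym2 (α ⊕ β) → ℤ_[p],
      (symMat y).toBlocks₂₁ = ((symMat y).toBlocks₁₂)ᵀ := fun y => by
    ext i j; exact (symMat_isSymm y).apply _ _
  have hMs : ∀ y, (M y).IsSymm := fun y => by
    refine hA.add (IsSymm.smul ?_ _)
    ext i j; exact (symMat_isSymm y).apply _ _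
  have hT : ∀ y, ((symMat y).toBlocks₂₂ - (p : ℤ_[p]) •
      ((symMat y).toBlocks₂₁ * (M y)⁻¹ * (symMat y).toBlocks₁₂)).IsSymm := fun y => by
    refine IsSymm.sub ?_ (IsSymm.smul ?_ _)
    · ext i j; exact (symMat_isSymm y).apply _ _
    · have h := isSymm_mul_mul_transpose (symMat y).toBlocks₂₁ (M := (M y)⁻¹) (by
        rw [IsSymm, transpose_nonsing_inv, (hMs y).eq])
      rwa [hblock, transpose_transpose, ← hblock] at h
  let T : (Sym2 (α ⊕ β) → ℤ_[p]) → (Sym2 β → ℤ_[p]) := fun y => symEntries _ (hT y)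
  have hmem : ∀ y, a + (p : ℤ_[p]) • y ∈ smithSet p (Sum.elim (0 : α → ℕ) fun j => k j + 1) ↔
      T y ∈ smithSet p k := fun y => by
    rw [smithSet, smithSet, Set.mem_ofPred_eq, Set.mem_ofPred_eq, symMat_symEntries,
      ← fromBlocks_mem_smithClass_iff (α := α) k (hM y)]
    have h : symMat (a + (p : ℤ_[p]) • y) = fromBlocks (M y)
        ((p : ℤ_[p]) • (symMat y).toBlocks₁₂) ((p : ℤ_[p]) • (symMat y).toBlocks₂₁)
        ((p : ℤ_[p]) • (symMat y).toBlocks₂₂) := by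
      rw [symMat_add, ha, symMat_smul]
      conv_lhs => rw [← fromBlocks_toBlocks (symMat y)]
      rw [fromBlocks_smul, fromBlocks_add, zero_add, zero_add, zero_add]
    rw [h]
  have hsub₁₁ : Continuous fun y : Sym2 (α ⊕ β) → ℤ_[p] => (symMat y).toBlocks₁₁ :=
    continuous_symMat.matrix_submatrix Sum.inl Sum.inl
  have hsub₁₂ : Continuous fun y : Sym2 (α ⊕ β) → ℤ_[p] => (symMat y).toBlocks₁₂ :=
    continuous_symMat.matrix_submatrix Sum.inl Sum.inr
  have hsub₂₁ : Continuous fun y : Sym2 (α ⊕ β) → ℤ_[p] => (symMat y).toBlocks₂₁ :=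
    continuous_symMat.matrix_submatrix Sum.inr Sum.inl
  have hsub₂₂ : Continuous fun y : Sym2 (α ⊕ β) → ℤ_[p] => (symMat y).toBlocks₂₂ :=
    continuous_symMat.matrix_submatrix Sum.inr Sum.inr
  have hMc : Continuous fun y => (M y)⁻¹ :=
    continuous_matrix_inv (continuous_const.add (hsub₁₁.const_smul (p : ℤ_[p]))) hM
  have hTm : Continuous fun y : Sym2 (α ⊕ β) → ℤ_[p] => (symMat y).toBlocks₂₂ - (p : ℤ_[p]) •
      ((symMat y).toBlocks₂₁ * (M y)⁻¹ * (symMat y).toBlocks₁₂) :=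
    hsub₂₂.sub (((hsub₂₁.matrix_mul hMc).matrix_mul hsub₁₂).const_smul (p : ℤ_[p]))
  have hTc : Continuous T := by
    refine continuous_pi fun e => ?_
    induction e with
    | _ i j => exact hTm.matrix_elem i j
  -- Adding `z` in the lower right block leaves the other blocks alone and hence translates the
  -- Schur complement by `z`, so `T` carries Haar to Haar.
  let j : (Sym2 β → ℤ_[p]) → (Sym2 (α ⊕ β) → ℤ_[p]) := fun z =>
    symEntries (fromBlocks 0 0 0 (symMat z))
      (IsSymm.fromBlocks isSymm_zero (by simp) (symMat_isSymm z))
  have hj : ∀ z y, T (j z + y) = z + T y := by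
    intro z y
    have h : symMat (j z + y) = fromBlocks 0 0 0 (symMat z) + symMat y := rfl
    have h11 : (symMat (j z + y)).toBlocks₁₁ = (symMat y).toBlocks₁₁ := by
      rw [h]; ext; simp [toBlocks₁₁]
    have h12 : (symMat (j z + y)).toBlocks₁₂ = (symMat y).toBlocks₁₂ := by
      rw [h]; ext; simp [toBlocks₁₂]
    have h21 : (symMat (j z + y)).toBlocks₂₁ = (symMat y).toBlocks₂₁ := by
      rw [h]; ext; simp [toBlocks₂₁]
    have h22 : (symMat (j z + y)).toBlocks₂₂ = symMat z + (symMat y).toBlocks₂₂ := by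
      rw [h]; ext; simp [toBlocks₂₂]
    have hMj : M (j z + y) = M y := by simp only [M, h11]
    apply symMat_injective
    rw [symMat_add]
    simp only [T, symMat_symEntries, h12, h21, h22, hMj]
    rw [add_sub_assoc]
  have hpres := measurePreserving_of_equivariant T hTc.measurable j hj
  rw [← hpres.measure_preimage (measurableSet_smithSet k).nullMeasurableSet]
  congr 1
  ext y
  exact hmem y

/-- The conditional law of the elementary divisors given a residue of the right rank. -/
theorem piHaar_lift_add (k : β → ℕ) (A : Sym2 (α ⊕ β) → ZMod p)
    (hr : (symMat A).rank = Fintype.card α) (a : Sym2 (α ⊕ β) → ℤ_[p])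
    (ha : ∀ e, PadicInt.toZMod (a e) = A e) :
    piHaar p (Sym2 (α ⊕ β))
      {y | a + (p : ℤ_[p]) • y ∈ smithSet p (Sum.elim (0 : α → ℕ) fun j => k j + 1)} =
    piHaar p (Sym2 β) (smithSet p k) := by
  obtain ⟨U, A', hA', hU⟩ := exists_congruent_fromBlocks (symMat A) (symMat_isSymm A) hr
  obtain ⟨V, hV⟩ := exists_lift_GL U
  set a' := congruence (V : Matrix (α ⊕ β) (α ⊕ β) ℤ_[p]) a with ha'
  have hares : (symMat a').map PadicInt.toZMod = fromBlocks A' 0 0 0 := by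
    have haA : (symMat a).map PadicInt.toZMod = symMat A := by
      ext i j; exact ha _
    rw [← hU, ha', symMat_congruence, Matrix.map_mul, Matrix.map_mul, transpose_map, hV, haA]
  set A₁ := (symMat a').toBlocks₁₁ with hA₁
  have hA₁s : A₁.IsSymm := by
    ext i j; exact (symMat_isSymm a').apply _ _
  have hA₁r : A₁.map PadicInt.toZMod = A' := by
    ext i j
    exact congrFun (congrFun hares (Sum.inl i)) (Sum.inl j)
  have hA₁u : IsUnit A₁ := by rw [isUnit_iff_isUnit_map_toZMod, hA₁r]; exact hA'
  have hs : (fromBlocks A₁ 0 0 0 : Matrix (α ⊕ β) (α ⊕ β) ℤ_[p]).IsSymm :=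
    IsSymm.fromBlocks hA₁s (by simp) isSymm_zero
  -- `a'` is block diagonal only modulo `p`; it is replaced by an exactly block diagonal matrix with
  -- the same residue.
  rw [← piHaar_fromBlocks_add k A₁ hA₁s hA₁u (symEntries _ hs) rfl,
    ← smul_add_preimage a' (symEntries _ hs)]
  · have hpre : {y | a + (p : ℤ_[p]) • y ∈ smithSet p (Sum.elim (0 : α → ℕ) fun j => k j + 1)} =
        congruence (V : Matrix (α ⊕ β) (α ⊕ β) ℤ_[p]) ⁻¹' {y | a' + (p : ℤ_[p]) • y ∈
          smithSet p (Sum.elim (0 : α → ℕ) fun j => k j + 1)} := by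
      ext y
      simp only [Set.mem_preimage, Set.mem_ofPred_eq, smithSet]
      rw [ha', ← congruence_smul, ← map_add, symMat_congruence,
        mul_mul_mem_smithClass_iff' V.isUnit ((isUnit_transpose _).mpr V.isUnit)]
    rw [hpre, (measurePreserving_congruence V).measure_preimage]
    refine (measurableSet_preimage ?_ (measurableSet_smithSet _)).nullMeasurableSet
    exact (show Continuous fun y : Sym2 (α ⊕ β) → ℤ_[p] =>
      a' + (p : ℤ_[p]) • y by fun_prop).measurable
  · have hM : (symMat a').map PadicInt.toZMod =
        (fromBlocks A₁ 0 0 0 : Matrix (α ⊕ β) (α ⊕ β) ℤ_[p]).map PadicInt.toZMod := by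
      rw [hares, fromBlocks_map, hA₁r]
      simp
    intro e
    induction e with
    | _ i j => exact congrFun (congrFun hM i) j

/-- Among all residues, only those of rank `card α` contribute, and each contributes the same
amount. The binomial coefficient is the number of unordered pairs. -/
theorem piHaar_smithSet_sum (k : β → ℕ) :
    (p : ENNReal) ^ (Fintype.card (α ⊕ β) + 1).choose 2 *
      piHaar p (Sym2 (α ⊕ β)) (smithSet p (Sum.elim (0 : α → ℕ) fun j => k j + 1)) =
    rankCount p (α ⊕ β) (Fintype.card α) * piHaar p (Sym2 β) (smithSet p k) := by
  classical
  choose s hs using ZMod.ringHom_surjective (PadicInt.toZMod (p := p))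
  have hcard : Fintype.card {i : α ⊕ β // Sum.elim (0 : α → ℕ) (fun j => k j + 1) i = 0} =
      Fintype.card α := by
    refine (Fintype.card_congr (Equiv.ofBijective (fun i : α => ⟨Sum.inl i, rfl⟩) ⟨?_, ?_⟩)).symm
    · intro i j hij
      exact Sum.inl_injective (congrArg Subtype.val hij)
    · rintro ⟨i | i, hi⟩
      · exact ⟨i, rfl⟩
      · exact absurd hi (Nat.succ_ne_zero _)
  rw [← Sym2.card, card_mul_piHaar s hs (measurableSet_smithSet _)]
  have hterm : ∀ A : Sym2 (α ⊕ β) → ZMod p, piHaar p (Sym2 (α ⊕ β))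
      {y | s ∘ A + (p : ℤ_[p]) • y ∈ smithSet p (Sum.elim (0 : α → ℕ) fun j => k j + 1)} =
      if (symMat A).rank = Fintype.card α then piHaar p (Sym2 β) (smithSet p k) else 0 := by
    intro A
    split_ifs with h
    · exact piHaar_lift_add k A h _ fun e => hs _
    · convert measure_empty (μ := piHaar p (Sym2 (α ⊕ β)))
      rw [Set.eq_empty_iff_forall_notMem]
      intro y hy
      apply h
      rw [← hcard, ← rank_map_toZMod_of_mem_smithClass hy]
      congr 1
      ext i j
      simp [hs]
  rw [Finset.sum_congr rfl fun A _ => hterm A, ← Finset.sum_filter, Finset.sum_const, nsmul_eq_mul,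
    ← Fintype.card_subtype, ← Nat.card_eq_fintype_card, rankCount]
  congr 2
  exact Nat.card_congr (Equiv.subtypeEquiv (symMatEquiv _ _) fun A => Iff.rfl)

theorem piHaar_smithSet_comp {ι κ : Type*} [Fintype ι] [Fintype κ] [DecidableEq ι] [DecidableEq κ]
    (e : κ ≃ ι) (k : ι → ℕ) :
    piHaar p (Sym2 κ) (smithSet p (k ∘ e)) = piHaar p (Sym2 ι) (smithSet p k) := by
  have h : MeasurePreserving (fun y : Sym2 ι → ℤ_[p] => fun s : Sym2 κ => y (s.map e))
      (piHaar p (Sym2 ι)) (piHaar p (Sym2 κ)) := by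
    refine measurePreserving_of_equivariant _ (by fun_prop)
      (fun z s => z (s.map e.symm)) fun z y => ?_
    ext s
    simp [Sym2.map_map]
  rw [← h.measure_preimage (measurableSet_smithSet _).nullMeasurableSet]
  congr 1
  ext y
  exact submatrix_mem_smithClass_iff (M := symMat y) e

end Recursion

end PadicSym

namespace PadicSym

open Matrix MeasureTheory

/-! ### The closed formula and the transfer to random matrices -/

section Formula

theorem exists_zero_iff_lt_of_monotone {n : ℕ} {k : Fin n → ℕ} (hk : Monotone k) :
    ∃ r m, n = r + m ∧ ∀ i, k i = 0 ↔ (i : ℕ) < r := by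
  classical
  have hex : ∃ r : ℕ, ∀ i : Fin n, r ≤ (i : ℕ) → k i ≠ 0 := ⟨n, fun i hi => absurd i.2 (by omega)⟩
  have hle : Nat.find hex ≤ n := Nat.find_le fun i hi => absurd i.2 (by omega)
  refine ⟨Nat.find hex, n - Nat.find hex, by omega, fun i => ⟨fun h => ?_, fun h => ?_⟩⟩
  · by_contra hlt
    exact Nat.find_spec hex i (by omega) h
  · have := Nat.find_min hex h
    push Not at this
    obtain ⟨j, hij, hj⟩ := this
    have := hk (show i ≤ j from hij)
    omega

theorem mult_eq_sum {n : ℕ} (k : Fin n → ℕ) (t : ℕ) : mult k t = ∑ i, if k i = t then 1 else 0 := by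
  rw [mult, Finset.card_filter]

theorem sum_fin_sub (m : ℕ) : ∑ j : Fin m, (m - (j : ℕ)) = (m + 1).choose 2 := by
  induction m with
  | zero => simp
  | succ m ih =>
    rw [Fin.sum_univ_succ, Nat.choose_succ_succ' (m + 1) 1, Nat.choose_one_right, ← ih]
    simp

theorem finprod_betaDens_mult (p : ℕ) {n : ℕ} (k : Fin n → ℕ) (b : ℕ) (hb : ∀ i, k i < b) :
    ∏ᶠ t : ℕ, betaDens p (mult k t) = ∏ t ∈ Finset.range b, betaDens p (mult k t) := by
  refine finprod_eq_prod_of_mulSupport_subset _ fun t ht => ?_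
  rw [Finset.coe_range, Set.mem_Iio]
  by_contra hlt
  refine ht ?_
  have h0 : mult k t = 0 := by
    rw [mult, Finset.card_eq_zero, Finset.filter_eq_empty_iff]
    intro i _
    have := hb i
    omega
  simp [h0, betaDens]

variable {p : ℕ} [Fact p.Prime] [MeasurableSpace ℤ_[p]] [BorelSpace ℤ_[p]]

theorem piHaar_real_smithSet_append (r m : ℕ) (k : Fin (r + m) → ℕ) (k' : Fin m → ℕ)
    (hk : k ∘ finSumFinEquiv = Sum.elim (0 : Fin r → ℕ) fun j => k' j + 1) :
    (piHaar p (Sym2 (Fin (r + m)))).real (smithSet p k) =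
      piDens p (r + m) / (betaDens p r * piDens p m) * ((p : ℝ) ^ (m + 1).choose 2)⁻¹ *
        (piHaar p (Sym2 (Fin m))).real (smithSet p k') := by
  have hp : (p : ℝ) ≠ 0 := by exact_mod_cast (Fact.out : p.Prime).ne_zero
  have h := congrArg ENNReal.toReal (piHaar_smithSet_sum (p := p) (α := Fin r) k')
  rw [← hk, piHaar_smithSet_comp, rankCount_congr p (finSumFinEquiv (m := r) (n := m)),
    ENNReal.toReal_mul, ENNReal.toReal_mul, ENNReal.toReal_pow, ENNReal.toReal_natCast,
    ENNReal.toReal_natCast, Fintype.card_fin, rankCount_fin p (r + m) r m rfl, Fintype.card_sum,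
    Fintype.card_fin, Fintype.card_fin, mul_assoc] at h
  exact mul_left_cancel₀ (pow_ne_zero _ hp) h

theorem piHaar_real_smithSet (b n : ℕ) (k : Fin n → ℕ) (hk : Monotone k) (hb : ∀ i, k i < b) :
    (piHaar p (Sym2 (Fin n))).real (smithSet p k) =
      piDens p n / (∏ t ∈ Finset.range b, betaDens p (mult k t)) *
        ∏ j : Fin n, ((p : ℝ) ^ (k j * (n - (j : ℕ))))⁻¹ := by
  -- Induction on a strict bound for `k`: removing the zeros and lowering the other values by one
  -- lowers the bound by one. The bound 0 forces `n = 0`.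
  induction b generalizing n with
  | zero =>
    obtain rfl : n = 0 := by
      by_contra h
      exact absurd (hb ⟨0, by omega⟩) (by omega)
    have : smithSet p k = Set.univ := by
      rw [Set.eq_univ_iff_forall]
      exact fun y => ⟨1, 1, Subsingleton.elim _ _⟩
    simp [this, piDens_zero]
  | succ b ih =>
    obtain ⟨r, m, rfl, hr⟩ := exists_zero_iff_lt_of_monotone hk
    set k' : Fin m → ℕ := fun j => k (Fin.natAdd r j) - 1 with hk'
    have hl : ∀ i : Fin r, k (Fin.castAdd m i) = 0 := fun i => (hr _).mpr (by simp)
    have hs : ∀ j : Fin m, k (Fin.natAdd r j) = k' j + 1 := fun j => by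
      have : k (Fin.natAdd r j) ≠ 0 := fun h => by
        have := (hr _).mp h
        simp at this
      simp only [hk']
      omega
    have hmono : Monotone k' := fun i j hij => by
      have := hk (show Fin.natAdd r i ≤ Fin.natAdd r j by simpa using hij)
      simp only [hk']
      omega
    have hcomp : k ∘ finSumFinEquiv = Sum.elim (0 : Fin r → ℕ) fun j => k' j + 1 := by
      ext (i | i)
      · simp [hl]
      · simp [hs]
    have hm0 : mult k 0 = r := by
      rw [mult_eq_sum, Fin.sum_univ_add]
      simp [hl, hs]
    have hms : ∀ t, mult k (t + 1) = mult k' t := fun t => by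
      rw [mult_eq_sum, mult_eq_sum, Fin.sum_univ_add]
      simp [hl, hs]
    -- Lowering the last `m` exponents by one takes out `p` to the power `-(m + ⋯ + 1)`, the power
    -- of `p` in the recursion.
    have hprod : ∏ j : Fin (r + m), ((p : ℝ) ^ (k j * (r + m - (j : ℕ))))⁻¹ =
        (∏ j : Fin m, ((p : ℝ) ^ (k' j * (m - (j : ℕ))))⁻¹) * ((p : ℝ) ^ (m + 1).choose 2)⁻¹ := by
      rw [Fin.prod_univ_add, ← sum_fin_sub, ← Finset.prod_pow_eq_pow_sum, ← Finset.prod_inv_distrib,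
        ← Finset.prod_mul_distrib]
      simp only [hl, hs, zero_mul, pow_zero, inv_one, Finset.prod_const_one, one_mul,
        Fin.val_natAdd, Nat.add_sub_add_left, add_mul, pow_add, mul_inv]
    rw [piHaar_real_smithSet_append r m k k' hcomp,
      ih m k' hmono (fun i => by have := hb (Fin.natAdd r i); have := hs i; omega), hprod,
      Finset.prod_range_succ', hm0]
    simp only [hms]
    have h1 := (piDens_pos p m).ne'
    have h2 := (betaDens_pos p r).ne'
    have h3 : ∏ t ∈ Finset.range b, betaDens p (mult k' t) ≠ 0 :=
      Finset.prod_ne_zero_iff.mpr fun t _ => (betaDens_pos p _).ne'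
    field_simp

variable {Ω : Type*} [MeasurableSpace Ω] {P : Measure Ω} [IsProbabilityMeasure P] {n : ℕ}
  {X : Ω → Matrix (Fin n) (Fin n) ℤ_[p]}

/-- The entries of a Haar symmetric matrix at unordered pairs have the product Haar law. -/
theorem IsHaarSymmetric.measurePreserving (hX : IsHaarSymmetric P p n X) :
    MeasurePreserving (fun ω => symEntries (X ω) (hX.symm ω)) P (piHaar p (Sym2 (Fin n))) := by
  have hentry : ∀ (s : Sym2 (Fin n)) (ω : Ω), symEntries (X ω) (hX.symm ω) s =
      X ω (Sym2.sortEquiv s).1.1 (Sym2.sortEquiv s).1.2 := by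
    intro s ω
    conv_lhs => rw [← Sym2.sortEquiv.symm_apply_apply s]
    rfl
  have hmeas : ∀ s : Sym2 (Fin n), Measurable fun ω => symEntries (X ω) (hX.symm ω) s := fun s => by
    simp only [hentry]
    exact hX.measurable _ _
  refine ⟨measurable_pi_lambda _ hmeas, ?_⟩
  -- Independence is given on pairs `i ≤ j`; sorting identifies these with unordered pairs.
  have hind := hX.indep.precomp (g := Sym2.sortEquiv (α := Fin n)) Sym2.sortEquiv.injective
  have hind' := (ProbabilityTheory.iIndepFun_iff_map_fun_eq_pi_map
    fun s => (hX.measurable _ _).aemeasurable).mp hind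
  rw [piHaar]
  convert hind' using 2
  · ext ω s
    exact hentry s ω
  · ext1 s
    exact (hX.map_eq _ _ (Sym2.sortEquiv s).2).symm

end Formula

end PadicSym

theorem mainTheorem2 (p : ℕ) [Fact p.Prime] (hp : p ≠ 2) :
    (∀ [MeasurableSpace ℤ_[p]] [BorelSpace ℤ_[p]]
        (n : ℕ) {Ω : Type*} [MeasurableSpace Ω] (P : MeasureTheory.Measure Ω)
        [MeasureTheory.IsProbabilityMeasure P]
        (X : Ω → Matrix (Fin n) (Fin n) ℤ_[p]) (_ : PadicSym.IsHaarSymmetric P p n X)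
        (k : Fin n → ℕ) (_ : Monotone k),
        MeasurableSet {ω | X ω ∈ PadicSym.divisorClass p n k} ∧
        P.real {ω | X ω ∈ PadicSym.divisorClass p n k} =
          PadicSym.piDens p n / (∏ᶠ t : ℕ, PadicSym.betaDens p (PadicSym.mult k t)) *
            ∏ j : Fin n, ((p : ℝ) ^ (k j * (n - (j : ℕ))))⁻¹) ∧
    (∀ t : ℕ, 1 ≤ t → ∀ r : ZMod p, ¬ IsSquare r →
        (PadicSym.betaDens p t)⁻¹ =
          (PadicSym.alphaDens p t 1)⁻¹ + (PadicSym.alphaDens p t r)⁻¹) := by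
  refine ⟨?_, fun t ht r hr => PadicSym.inv_betaDens_eq p hp t ht r hr⟩
  intro _ _ n Ω _ P _ X hX k hk
  have hY := hX.measurePreserving
  have hset : MeasurableSet (PadicSym.smithSet p k) := PadicSym.measurableSet_smithSet k
  -- Any strict bound on `k` serves: larger values have multiplicity zero and contribute `β_0 = 1`.
  have hb : ∀ i, k i < Finset.univ.sup k + 1 := fun i =>
    Nat.lt_succ_of_le (Finset.le_sup (Finset.mem_univ i))
  refine ⟨hY.measurable hset, ?_⟩
  rw [PadicSym.finprod_betaDens_mult p k _ hb, ← PadicSym.piHaar_real_smithSet _ n k hk hb,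
    MeasureTheory.Measure.real, MeasureTheory.Measure.real,
    ← hY.measure_preimage hset.nullMeasurableSet]
  rfl
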